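/- **Theorem (completeness of the discrete scale-invariant Sobolev metrics).** Let $m\ge 2$, $n\ge 3$ and $d\ge 2$ be integers, and let $$\mathbb{R}^{d\times n}_*=\{c=(c_i)_{i\in\mathbb{Z}/n\mathbb{Z}} : c_i\in\mathbb{R}^d,\ c_i\ne c_{i+1}\text{ for all } i\in\mathbb{Z}/n\mathbb{Z}\},$$ an open subset of $\mathbb{R}^{d\times n}=(\mathbb{R}^d)^{\mathbb{Z}/n\mathbb{Z}}$, so that every tangent space is identified with $\mathbb{R}^{d\times n}$. For $c\in\mathbb{R}^{d\times n}_*$ put $e_i=c_{i+1}-c_i$, $\mu_i=\frac12(|e_i|+|e_{i-1}|)$ and $\ell(c)=\sum_i|e_i|$. For $h\in\mathbb{R}^{d\times n}$ define recursively $D_s^0h_i=h_i$ and $$D_s^{j+1}h_i=\begin{cases}\dfrac{D_s^jh_{i+1}-D_s^jh_i}{|e_i|}, & j\text{ even},\\[2mm] \dfrac{D_s^jh_i-D_s^jh_{i-1}}{\mu_i}, & j\text{ odd}.\end{cases}$$ For integers $r\ge 0$ let $\mu_{i,r}=\mu_i$ if $r$ is even and $\mu_{i,r}=|e_i|$ if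 $r$ is odd, let $$\dot g^r_c(h,k)=\sum_{i\in\mathbb{Z}/n\mathbb{Z}}\ell(c)^{2r-3}\langle D_s^rh_i,D_s^rk_i\rangle\,\mu_{i,r},$$ and let $g^m_c(h,k)=\dot g^0_c(h,k)+\dot g^m_c(h,k)$, which is a smooth Riemannian metric on $\mathbb{R}^{d\times n}_*$. Its geodesic distance $d_{g^m}(p,q)$ is the infimum of the lengths $L(\gamma)=\int_0^1\sqrt{g^m_{\gamma(t)}(\gamma'(t),\gamma'(t))}\,dt$ over all piecewise $C^\infty$ paths $\gamma:[0,1]\to\mathbb{R}^{d\times n}_*$ from $p$ to $q$. Then: 1. (Metric completeness) $d_{g^m}$ is a (finite) metric on $\mathbb{R}^{d\times n}_*$, and $(\mathbb{R}^{d\times n}_*,d_{g^m})$ is a complete metric space. 2. (Geodesic completeness) For every $p\in\mathbb{R}^{d\times n}_*$ and $v\in\mathbb{R}^{d\times n}$ there is a smooth solution $\gamma:\mathbb{R}\to\mathbb{R}^{d\times n}_*$ of the geodesic equation of $g^m$, defined for all times, with $\gamma(0)=p$ and $\gamma'(0)=v$. 3. (Geodesic convexity) For any two points $p,q\in\mathbb{R}^{d\times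 n}_*$ there is a geodesic $\gamma:[0,1]\to\mathbb{R}^{d\times n}_*$ of $g^m$ with $\gamma(0)=p$, $\gamma(1)=q$ and $L(\gamma)=d_{g^m}(p,q)$. -/

import Mathlib

open scoped ContDiff

noncomputable section

/-! ## Riemannian geometry on an open subset of a finite-dimensional real vector space

All tangent spaces of an open set `U` in `E` are identified with `E`. -/

section Riemannian

variable {E : Type*} [NormedAddCommGroup E] [NormedSpace ℝ E]

/-- A smooth Riemannian metric on the open set `U`. Only the values of `form` at points of `U`
matter. -/
structure RiemannianMetricOn (U : TopologicalSpace.Opens E) where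
  form : E → LinearMap.BilinForm ℝ E
  symm : ∀ x ∈ U, ∀ v w, form x v w = form x w v
  pos : ∀ x ∈ U, ∀ v, v ≠ 0 → 0 < form x v v
  smooth : ∀ v w, ContDiffOn ℝ ∞ (fun x => form x v w) U

/-- `γ` restricted to `[0, 1]` is a piecewise smooth path in `U` from `p` to `q`. -/
structure IsPiecewiseSmoothPath (U : TopologicalSpace.Opens E) (γ : ℝ → E) (p q : E) : Prop where
  source : γ 0 = p
  target : γ 1 = q
  mem : ∀ t ∈ Set.Icc (0 : ℝ) 1, γ t ∈ U
  continuousOn : ContinuousOn γ (Set.Icc 0 1)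
  piecewise : ∃ (k : ℕ) (τ : ℕ → ℝ), Monotone τ ∧ τ 0 = 0 ∧ τ k = 1 ∧
    ∀ i < k, ContDiffOn ℝ ∞ γ (Set.Icc (τ i) (τ (i + 1)))

namespace RiemannianMetricOn

variable {U : TopologicalSpace.Opens E} (g : RiemannianMetricOn U)

/-- The length `∫₀¹ √(g_γ(γ', γ')) dt` of the restriction of `γ` to `[0, 1]`. -/
def length (γ : ℝ → E) : ENNReal :=
  ∫⁻ t in Set.Icc (0 : ℝ) 1, ENNReal.ofReal (√(g.form (γ t) (deriv γ t) (deriv γ t)))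

/-- The geodesic distance: the infimum of the lengths of piecewise smooth paths in `U` that
connect the two points (it is `∞` if there is no such path). -/
def geodesicDist (p q : U) : ENNReal :=
  ⨅ (γ : ℝ → E) (_ : IsPiecewiseSmoothPath U γ p q), g.length γ

/-- The Christoffel symbols of the first kind,
`Γ(u, v; w) = (∂_u g(v, w) + ∂_v g(u, w) - ∂_w g(u, v)) / 2`. -/
def christoffel (x u v w : E) : ℝ :=
  (fderiv ℝ (fun y => g.form y v w) x u + fderiv ℝ (fun y => g.form y u w) x v
    - fderiv ℝ (fun y => g.form y u v) x w) / 2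

/-- `γ` is a geodesic on the (nondegenerate) interval `J`: a smooth curve in `U` that satisfies
the geodesic equation `γ'' + Γ(γ', γ') = 0`, written with its index lowered by `g`. -/
structure IsGeodesicOn (γ : ℝ → E) (J : Set ℝ) : Prop where
  mem : ∀ t ∈ J, γ t ∈ U
  smooth : ContDiffOn ℝ ∞ γ J
  equation : ∀ t ∈ J, ∀ w : E,
    g.form (γ t) (derivWithin (derivWithin γ J) J t) w
      + g.christoffel (γ t) (derivWithin γ J t) (derivWithin γ J t) w = 0

/-- The geodesic distance is a (finite, nondegenerate) metric on `U` for which `U` is a complete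
metric space. -/
def MetricallyComplete : Prop :=
  ∃ M : MetricSpace U, (∀ p q : U, M.edist p q = g.geodesicDist p q) ∧
    @CompleteSpace U M.toUniformSpace

/-- For all initial conditions the geodesic equation has a solution defined for all times. -/
def GeodesicallyComplete : Prop :=
  ∀ p ∈ U, ∀ v : E, ∃ γ : ℝ → E, g.IsGeodesicOn γ Set.univ ∧ γ 0 = p ∧ deriv γ 0 = v

/-- Any two points are connected by a geodesic whose length is their geodesic distance. -/
def GeodesicallyConvex : Prop :=
  ∀ p q : U, ∃ γ : ℝ → E, g.IsGeodesicOn γ (Set.Icc 0 1) ∧ γ 0 = p ∧ γ 1 = q ∧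
    g.length γ = g.geodesicDist p q

end RiemannianMetricOn

end Riemannian

/-! ## Discrete regular curves and the discrete scale-invariant Sobolev metrics -/

namespace DiscreteCurve

/-- `n`-tuples of points of `ℝᵈ`, indexed cyclically. The norm of the pi type only serves to
provide the topology and the smooth structure. -/
abbrev Space (d n : ℕ) : Type := ZMod n → EuclideanSpace ℝ (Fin d)

variable {d n : ℕ}

/-- The edge `e_i = c_{i+1} - c_i`. -/
def edge (c : Space d n) (i : ZMod n) : EuclideanSpace ℝ (Fin d) := c (i + 1) - c i

/-- The average length `μ_i` of the two edges that meet at the vertex `c_i`. -/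
def vertexWeight (c : Space d n) (i : ZMod n) : ℝ := (‖edge c i‖ + ‖edge c (i - 1)‖) / 2

/-- The length `ℓ(c)` of the closed polygon `c`. -/
def curveLength [NeZero n] (c : Space d n) : ℝ := ∑ i, ‖edge c i‖

/-- The discrete arc length derivative `D_s^j h_i` along `c`. -/
def discreteDeriv (c h : Space d n) : ℕ → ZMod n → EuclideanSpace ℝ (Fin d)
  | 0, i => h i
  | j + 1, i =>
    if Even j then ‖edge c i‖⁻¹ • (discreteDeriv c h j (i + 1) - discreteDeriv c h j i)
    else (vertexWeight c i)⁻¹ • (discreteDeriv c h j i - discreteDeriv c h j (i - 1))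

/-- The weight `μ_{i,m}`. -/
def weight (m : ℕ) (c : Space d n) (i : ZMod n) : ℝ :=
  if Even m then vertexWeight c i else ‖edge c i‖

/-- The homogeneous form of order `m`,
`∑ i, ℓ(c) ^ (2m - 3) ⟨D_s^m h_i, D_s^m k_i⟩ μ_{i,m}`. -/
def homogeneousForm [NeZero n] (m : ℕ) (c h k : Space d n) : ℝ :=
  ∑ i, curveLength c ^ (2 * (m : ℤ) - 3) *
    inner ℝ (discreteDeriv c h m i) (discreteDeriv c k m i) * weight m c i

/-- The discrete Sobolev metric of order `m`, as a function of a base point and two tangent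
vectors. -/
def sobolevForm [NeZero n] (m : ℕ) (c h k : Space d n) : ℝ :=
  homogeneousForm 0 c h k + homogeneousForm m c h k

variable (d n) in
/-- The open set of discrete regular curves: consecutive points are distinct. -/
def regularCurves [NeZero n] : TopologicalSpace.Opens (Space d n) where
  carrier := {c | ∀ i, c i ≠ c (i + 1)}
  is_open' := by
    simp only [Set.ofPred_forall]
    exact isOpen_iInter_of_finite fun i =>
      isOpen_ne_fun (continuous_apply i) (continuous_apply (i + 1))

theorem mem_regularCurves [NeZero n] {c : Space d n} :
    c ∈ regularCurves d n ↔ ∀ i, c i ≠ c (i + 1) := Iff.rfl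

theorem discreteDeriv_add (c h k : Space d n) (j : ℕ) (i : ZMod n) :
    discreteDeriv c (h + k) j i = discreteDeriv c h j i + discreteDeriv c k j i := by
  induction j generalizing i with
  | zero => rfl
  | succ j ih =>
    simp only [discreteDeriv, ih]
    split_ifs <;> rw [← smul_add] <;> congr 1 <;> abel

theorem discreteDeriv_smul (c : Space d n) (a : ℝ) (h : Space d n) (j : ℕ) (i : ZMod n) :
    discreteDeriv c (a • h) j i = a • discreteDeriv c h j i := by
  induction j generalizing i with
  | zero => rfl
  | succ j ih =>
    simp only [discreteDeriv, ih]
    split_ifs <;> rw [← smul_sub, smul_comm]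

section Bundling

variable [NeZero n]

theorem homogeneousForm_add_left (m : ℕ) (c h h' k : Space d n) :
    homogeneousForm m c (h + h') k = homogeneousForm m c h k + homogeneousForm m c h' k := by
  simp only [homogeneousForm, discreteDeriv_add, inner_add_left, mul_add, add_mul,
    Finset.sum_add_distrib]

theorem homogeneousForm_smul_left (m : ℕ) (c : Space d n) (a : ℝ) (h k : Space d n) :
    homogeneousForm m c (a • h) k = a * homogeneousForm m c h k := by
  simp only [homogeneousForm, discreteDeriv_smul, real_inner_smul_left, Finset.mul_sum]
  exact Finset.sum_congr rfl fun i _ => by ring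

theorem homogeneousForm_comm (m : ℕ) (c h k : Space d n) :
    homogeneousForm m c h k = homogeneousForm m c k h := by
  simp only [homogeneousForm, real_inner_comm]

theorem sobolevForm_comm (m : ℕ) (c h k : Space d n) :
    sobolevForm m c h k = sobolevForm m c k h := by
  simp only [sobolevForm, homogeneousForm_comm _ c h k]

theorem sobolevForm_add_left (m : ℕ) (c h h' k : Space d n) :
    sobolevForm m c (h + h') k = sobolevForm m c h k + sobolevForm m c h' k := by
  simp only [sobolevForm, homogeneousForm_add_left]; ring

theorem sobolevForm_smul_left (m : ℕ) (c : Space d n) (a : ℝ) (h k : Space d n) :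
    sobolevForm m c (a • h) k = a * sobolevForm m c h k := by
  simp only [sobolevForm, homogeneousForm_smul_left]; ring

theorem norm_edge_pos {c : Space d n} (hc : c ∈ regularCurves d n) (i : ZMod n) :
    0 < ‖edge c i‖ :=
  norm_pos_iff.2 (sub_ne_zero.2 (hc i).symm)

theorem vertexWeight_pos {c : Space d n} (hc : c ∈ regularCurves d n) (i : ZMod n) :
    0 < vertexWeight c i := by
  have := norm_edge_pos hc i
  have := norm_edge_pos hc (i - 1)
  unfold vertexWeight
  positivity

theorem curveLength_pos {c : Space d n} (hc : c ∈ regularCurves d n) : 0 < curveLength c :=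
  Finset.sum_pos (fun i _ => norm_edge_pos hc i) Finset.univ_nonempty

theorem weight_pos (m : ℕ) {c : Space d n} (hc : c ∈ regularCurves d n) (i : ZMod n) :
    0 < weight m c i := by
  unfold weight
  split_ifs
  · exact vertexWeight_pos hc i
  · exact norm_edge_pos hc i

theorem homogeneousForm_self_nonneg (m : ℕ) {c : Space d n} (hc : c ∈ regularCurves d n)
    (h : Space d n) : 0 ≤ homogeneousForm m c h h :=
  Finset.sum_nonneg fun i _ => mul_nonneg
    (mul_nonneg (zpow_nonneg (curveLength_pos hc).le _) real_inner_self_nonneg)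
    (weight_pos m hc i).le

theorem sobolevForm_self_pos (m : ℕ) {c : Space d n} (hc : c ∈ regularCurves d n)
    {h : Space d n} (hh : h ≠ 0) : 0 < sobolevForm m c h h := by
  obtain ⟨i, hi⟩ := Function.ne_iff.1 hh
  refine add_pos_of_pos_of_nonneg (Finset.sum_pos' (fun j _ => ?_) ⟨i, Finset.mem_univ i, ?_⟩)
    (homogeneousForm_self_nonneg m hc h)
  · exact mul_nonneg (mul_nonneg (zpow_nonneg (curveLength_pos hc).le _) real_inner_self_nonneg)
      (weight_pos 0 hc j).le
  · exact mul_pos (mul_pos (zpow_pos (curveLength_pos hc) _) (real_inner_self_pos.2 hi))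
      (weight_pos 0 hc i)

theorem contDiffOn_norm_edge (i : ZMod n) :
    ContDiffOn ℝ ∞ (fun c : Space d n => ‖edge c i‖) (regularCurves d n) := by
  refine ContDiffOn.norm ℝ ?_ fun c hc => norm_pos_iff.1 (norm_edge_pos hc i)
  unfold edge
  fun_prop

theorem contDiffOn_vertexWeight (i : ZMod n) :
    ContDiffOn ℝ ∞ (fun c : Space d n => vertexWeight c i) (regularCurves d n) :=
  ((contDiffOn_norm_edge i).add (contDiffOn_norm_edge (i - 1))).div_const 2

theorem contDiffOn_curveLength :
    ContDiffOn ℝ ∞ (fun c : Space d n => curveLength c) (regularCurves d n) :=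
  ContDiffOn.sum fun i _ => contDiffOn_norm_edge i

theorem contDiffOn_discreteDeriv (h : Space d n) (j : ℕ) (i : ZMod n) :
    ContDiffOn ℝ ∞ (fun c : Space d n => discreteDeriv c h j i) (regularCurves d n) := by
  induction j generalizing i with
  | zero => exact contDiffOn_const
  | succ j ih =>
    simp only [discreteDeriv]
    split_ifs
    · exact ((contDiffOn_norm_edge i).inv fun c hc => (norm_edge_pos hc i).ne').smul
        ((ih (i + 1)).sub (ih i))
    · exact ((contDiffOn_vertexWeight i).inv fun c hc => (vertexWeight_pos hc i).ne').smul
        ((ih i).sub (ih (i - 1)))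

theorem contDiffOn_homogeneousForm (m : ℕ) (h k : Space d n) :
    ContDiffOn ℝ ∞ (fun c : Space d n => homogeneousForm m c h k) (regularCurves d n) := by
  refine ContDiffOn.sum fun i _ => ContDiffOn.mul (ContDiffOn.mul ?_
    ((contDiffOn_discreteDeriv h m i).inner ℝ (contDiffOn_discreteDeriv k m i))) ?_
  · generalize 2 * (m : ℤ) - 3 = z
    cases z with
    | ofNat a => simpa using contDiffOn_curveLength.pow a
    | negSucc a =>
      simp only [zpow_negSucc]
      exact (contDiffOn_curveLength.pow _).inv fun c hc => (pow_pos (curveLength_pos hc) _).ne'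
  · unfold weight
    split_ifs
    · exact contDiffOn_vertexWeight i
    · exact contDiffOn_norm_edge i

variable (d n) in
/-- The discrete scale-invariant Sobolev metric `g^m` on the space of discrete regular curves. -/
def sobolevMetric (m : ℕ) : RiemannianMetricOn (regularCurves d n) where
  form c := LinearMap.mk₂ ℝ (sobolevForm m c) (sobolevForm_add_left m c)
    (sobolevForm_smul_left m c)
    (fun h k k' => by simp only [sobolevForm_comm m c h, sobolevForm_add_left])
    (fun a h k => by simp only [sobolevForm_comm m c h, sobolevForm_smul_left, smul_eq_mul])
  symm c _ h k := sobolevForm_comm m c h k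
  pos _ hc _ hh := sobolevForm_self_pos m hc hh
  smooth h k := (contDiffOn_homogeneousForm 0 h k).add (contDiffOn_homogeneousForm m h k)

end Bundling

end DiscreteCurve

end

/-! # Completeness of the discrete scale-invariant Sobolev metrics

The proof has a general part, a Hopf-Rinow theorem for a Riemannian metric on an open subset `U` of a
finite-dimensional vector space, and a part that is specific to the discrete Sobolev metrics.

The general part assumes that the geodesic distance is finite and that the metric is *proper*
(`RiemannianMetricOn.IsProper`): balls for the geodesic distance are contained in compact subsets of
`U`. On compact sets the geodesic distance is comparable with the norm, which turns a Cauchy sequence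
into a convergent one (`RiemannianMetricOn.IsProper.metricallyComplete`). Geodesics are treated as
solutions of the Hamiltonian equations on `U × E*`. Their speed is constant, so within bounded time
they stay in a compact set and can be continued
(`RiemannianMetricOn.IsProper.geodesicallyComplete`).

Minimising geodesics are found without the exponential map, by a discretisation
(`RiemannianMetricOn.IsProper.exists_minimizing_hamiltonian`). Among polygons with `N` edges that join
`p` to `q`, take a minimiser of `N ∑ g(x i)(x (i + 1) - x i, x (i + 1) - x i)`. Its energy is at most
the square of the geodesic distance, up to an error that tends to zero; it stays in a fixed ball; and
its Euler-Lagrange equations say that it is a step by step (symplectic) Euler approximation of a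
solution of the Hamiltonian equations. Its momenta are bounded, so along a subsequence the initial
momenta converge, and by a discrete Grönwall estimate the polygons converge to the Hamiltonian
solution with the limiting initial momentum. This solution ends at `q`, and its speed, which is its
length, is at most the geodesic distance.

For the discrete Sobolev metrics the distance is finite since two curves can be joined by two
segments: a third curve can be chosen so that none of its edges is parallel to the corresponding edge
of the other two, because a vector space is not a finite union of proper subspaces and `d ≥ 2`.
Properness (`DiscreteCurve.isProper_sobolevMetric`) rests on the scale-invariant estimate
`|D_s h| ≤ n ^ (m - 1) √g(h, h)` (`DiscreteCurve.norm_discreteDeriv_one_le`), obtained from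
`m - 1` discrete Poincaré inequalities. It says that the logarithms of the edge lengths are Lipschitz
functions of the curve, so on a ball the edge lengths are bounded from above and from below, and then
the zeroth order part of the metric bounds the positions of the vertices. -/

noncomputable section

open Set MeasureTheory Filter Topology

namespace RiemannianMetricOn

/-! ### The metric as a smooth family of continuous bilinear forms -/

section BilinearForm

variable {E : Type*} [NormedAddCommGroup E] [NormedSpace ℝ E]
  {U : TopologicalSpace.Opens E} (g : RiemannianMetricOn U)

/-- The length of the tangent vector `v` at the point `x`. -/
def tangentNorm (x v : E) : ℝ := √(g.form x v v)

theorem tangentNorm_nonneg (x v : E) : 0 ≤ g.tangentNorm x v := Real.sqrt_nonneg _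

theorem form_self_nonneg {x : E} (hx : x ∈ U) (v : E) : 0 ≤ g.form x v v := by
  rcases eq_or_ne v 0 with rfl | hv
  · simp
  · exact (g.pos x hx v hv).le

theorem sq_tangentNorm {x : E} (hx : x ∈ U) (v : E) : g.tangentNorm x v ^ 2 = g.form x v v :=
  Real.sq_sqrt (g.form_self_nonneg hx v)

theorem tangentNorm_smul (x : E) (a : ℝ) (v : E) :
    g.tangentNorm x (a • v) = |a| * g.tangentNorm x v := by
  simp only [tangentNorm, map_smul, LinearMap.smul_apply, smul_eq_mul]
  rw [← mul_assoc, Real.sqrt_mul (mul_self_nonneg a), Real.sqrt_mul_self_eq_abs]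

theorem tangentNorm_zero (x : E) : g.tangentNorm x 0 = 0 := by simp [tangentNorm]

theorem form_le_tangentNorm_mul {x : E} (hx : x ∈ U) (v w : E) :
    g.form x v w ≤ g.tangentNorm x v * g.tangentNorm x w := by
  have h := LinearMap.BilinForm.apply_sq_le_of_symm (g.form x) (g.form_self_nonneg hx)
    ⟨fun v w => g.symm x hx v w⟩ v w
  refine le_of_sq_le_sq ?_ (mul_nonneg (g.tangentNorm_nonneg x v) (g.tangentNorm_nonneg x w))
  rwa [mul_pow, g.sq_tangentNorm hx, g.sq_tangentNorm hx]

variable [FiniteDimensional ℝ E]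

/-- The metric at `x` as a continuous bilinear form. -/
def toCLM (x : E) : E →L[ℝ] E →L[ℝ] ℝ :=
  LinearMap.toContinuousLinearMap
    ((LinearMap.toContinuousLinearMap : (E →ₗ[ℝ] ℝ) ≃ₗ[ℝ] E →L[ℝ] ℝ).toLinearMap ∘ₗ g.form x)

@[simp]
theorem toCLM_apply (x v w : E) : g.toCLM x v w = g.form x v w := rfl

theorem contDiffOn_toCLM : ContDiffOn ℝ ∞ g.toCLM U :=
  contDiffOn_clm_apply.2 fun v => contDiffOn_clm_apply.2 fun w => g.smooth v w

theorem continuousOn_toCLM : ContinuousOn g.toCLM U := g.contDiffOn_toCLM.continuousOn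

theorem continuousOn_tangentNorm : ContinuousOn (fun z : E × E => g.tangentNorm z.1 z.2)
    ((U : Set E) ×ˢ univ) := by
  have h : ContinuousOn (fun z : E × E => g.toCLM z.1) ((U : Set E) ×ˢ univ) :=
    g.continuousOn_toCLM.comp continuousOn_fst fun z hz => hz.1
  exact ((h.clm_apply continuousOn_snd).clm_apply continuousOn_snd).sqrt

end BilinearForm

/-! ### Piecewise smooth curves and their lengths -/

section Paths

variable {E : Type*} [NormedAddCommGroup E] [NormedSpace ℝ E]
  {U : TopologicalSpace.Opens E} (g : RiemannianMetricOn U)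

/-- `PiecewiseSmoothOn U γ a b`: on `[a, b]`, the curve `γ` is a finite concatenation of smooth
curves in `U`. -/
inductive PiecewiseSmoothOn (U : TopologicalSpace.Opens E) (γ : ℝ → E) : ℝ → ℝ → Prop
  | smooth {a b : ℝ} (hab : a ≤ b) (mem : ∀ t ∈ Icc a b, γ t ∈ U)
      (h : ContDiffOn ℝ ∞ γ (Icc a b)) : PiecewiseSmoothOn U γ a b
  | trans {a b c : ℝ} (h₁ : PiecewiseSmoothOn U γ a b) (h₂ : PiecewiseSmoothOn U γ b c) :
      PiecewiseSmoothOn U γ a c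

namespace PiecewiseSmoothOn

variable {γ γ' : ℝ → E} {a b : ℝ}

theorem le (h : PiecewiseSmoothOn U γ a b) : a ≤ b := by
  induction h with
  | smooth hab => exact hab
  | trans _ _ h₁ h₂ => exact h₁.trans h₂

theorem mem (h : PiecewiseSmoothOn U γ a b) : ∀ t ∈ Icc a b, γ t ∈ U := by
  induction h with
  | smooth _ mem => exact mem
  | @trans a b c _ _ h₁ h₂ =>
    intro t ht
    rcases le_total t b with h | h
    exacts [h₁ t ⟨ht.1, h⟩, h₂ t ⟨h, ht.2⟩]

theorem left_mem (h : PiecewiseSmoothOn U γ a b) : γ a ∈ U := h.mem a (left_mem_Icc.2 h.le)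

theorem continuousOn (h : PiecewiseSmoothOn U γ a b) : ContinuousOn γ (Icc a b) := by
  induction h with
  | smooth _ _ h => exact h.continuousOn
  | trans h₁ h₂ ih₁ ih₂ =>
    rw [← Icc_union_Icc_eq_Icc h₁.le h₂.le]
    exact ih₁.union_of_isClosed ih₂ isClosed_Icc isClosed_Icc

theorem congr (h : PiecewiseSmoothOn U γ a b) (heq : EqOn γ' γ (Icc a b)) :
    PiecewiseSmoothOn U γ' a b := by
  induction h with
  | smooth hab mem h => exact smooth hab (fun t ht => heq ht ▸ mem t ht) (h.congr heq)
  | trans h₁ h₂ ih₁ ih₂ =>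
    exact (ih₁ (heq.mono (Icc_subset_Icc_right h₂.le))).trans
      (ih₂ (heq.mono (Icc_subset_Icc_left h₁.le)))

theorem restrict (h : PiecewiseSmoothOn U γ a b) {s t : ℝ} (hs : a ≤ s) (hst : s ≤ t)
    (ht : t ≤ b) : PiecewiseSmoothOn U γ s t := by
  induction h generalizing s t with
  | smooth hab mem h =>
    exact smooth hst (fun r hr => mem r ⟨hs.trans hr.1, hr.2.trans ht⟩)
      (h.mono (Icc_subset_Icc hs ht))
  | @trans a b c h₁ h₂ ih₁ ih₂ =>
    rcases le_total t b with h | h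
    · exact ih₁ hs hst h
    rcases le_total s b with h' | h'
    · exact (ih₁ hs h' le_rfl).trans (ih₂ le_rfl h ht)
    · exact ih₂ h' hst ht

theorem comp_affine (h : PiecewiseSmoothOn U γ a b) {c e a' b' : ℝ} (hc : 0 < c)
    (ha : c * a' + e = a) (hb : c * b' + e = b) :
    PiecewiseSmoothOn U (fun u => γ (c * u + e)) a' b' := by
  induction h generalizing a' b' with
  | @smooth a b hab mem h =>
    have hmaps : MapsTo (fun u => c * u + e) (Icc a' b') (Icc a b) := by
      intro u hu
      rw [← ha, ← hb]
      constructor <;> dsimp only <;> gcongr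
      exacts [hu.1, hu.2]
    refine smooth ?_ (fun u hu => mem _ (hmaps hu)) (h.comp (by fun_prop) hmaps)
    by_contra! hlt
    nlinarith
  | @trans a b _ h₁ h₂ ih₁ ih₂ =>
    have hm : c * ((b - e) / c) + e = b := by field_simp; ring
    exact (ih₁ ha hm).trans (ih₂ hm hb)

theorem comp_neg (h : PiecewiseSmoothOn U γ a b) :
    PiecewiseSmoothOn U (fun u => γ (-u)) (-b) (-a) := by
  induction h with
  | @smooth a b hab mem h =>
    have hmaps : MapsTo (fun u : ℝ => -u) (Icc (-b) (-a)) (Icc a b) := fun u hu =>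
      ⟨le_neg.1 hu.2, neg_le.1 hu.1⟩
    exact smooth (neg_le_neg hab) (fun u hu => mem _ (hmaps hu)) (h.comp (by fun_prop) hmaps)
  | trans h₁ h₂ ih₁ ih₂ => exact ih₂.trans ih₁

theorem exists_subdivision (h : PiecewiseSmoothOn U γ a b) :
    ∃ (k : ℕ) (τ : ℕ → ℝ), Monotone τ ∧ τ 0 = a ∧ τ k = b ∧
      ∀ i < k, ContDiffOn ℝ ∞ γ (Icc (τ i) (τ (i + 1))) := by
  induction h with
  | @smooth a b hab mem h =>
    refine ⟨1, fun i => if i = 0 then a else b, ?_, by simp, by simp, fun i hi => ?_⟩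
    · intro i j hij
      dsimp only
      split_ifs <;> first | rfl | assumption | omega
    · obtain rfl : i = 0 := by omega
      simpa using h
  | trans h₁ h₂ ih₁ ih₂ =>
    obtain ⟨k, τ, hτ, h0, hk, hs⟩ := ih₁
    obtain ⟨l, σ, hσ, g0, gl, gs⟩ := ih₂
    refine ⟨k + l, fun i => if i ≤ k then τ i else σ (i - k), ?_, by simpa using h0, ?_, ?_⟩
    · refine monotone_nat_of_le_succ fun i => ?_
      rcases lt_trichotomy i k with hi | rfl | hi
      · rw [if_pos (by omega), if_pos (by omega)]; exact hτ (by omega)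
      · rw [if_pos le_rfl, if_neg (by omega), hk, ← g0]; exact hσ (by omega)
      · rw [if_neg (by omega), if_neg (by omega)]; exact hσ (by omega)
    · rcases Nat.eq_zero_or_pos l with rfl | hl
      · simp only [add_zero, le_refl, if_true]
        rw [hk, ← g0, gl]
      · simp only
        rw [if_neg (by omega), Nat.add_sub_cancel_left, gl]
    · intro i hi
      rcases lt_trichotomy i k with hik | rfl | hik
      · simp only [if_pos hik.le, if_pos (Nat.succ_le_of_lt hik)]
        exact hs i hik
      · simp only [le_refl, if_true, if_neg (Nat.not_succ_le_self i), Nat.add_sub_cancel_left]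
        rw [hk, ← g0]
        exact gs 0 (by omega)
      · simp only [if_neg (by omega : ¬ i ≤ k), if_neg (by omega : ¬ i + 1 ≤ k)]
        rw [Nat.sub_add_comm hik.le]
        exact gs _ (by omega)

end PiecewiseSmoothOn

theorem isPiecewiseSmoothPath_iff {γ : ℝ → E} {p q : E} :
    IsPiecewiseSmoothPath U γ p q ↔ PiecewiseSmoothOn U γ 0 1 ∧ γ 0 = p ∧ γ 1 = q := by
  constructor
  · intro h
    refine ⟨?_, h.source, h.target⟩
    obtain ⟨k, τ, hτ, h0, hk, hs⟩ := h.piecewise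
    have key : ∀ j ≤ k, PiecewiseSmoothOn U γ 0 (τ j) := by
      intro j hj
      induction j with
      | zero =>
        rw [h0]
        refine .smooth le_rfl (fun t ht => h.mem t (Icc_subset_Icc_right zero_le_one ht)) ?_
        rw [Icc_self]
        intro t ht
        rw [mem_singleton_iff.1 ht]
        exact contDiffWithinAt_singleton
      | succ j ih =>
        refine (ih (by omega)).trans (.smooth (hτ (by omega)) (fun t ht => h.mem t ?_)
          (hs j (by omega)))
        have h1 := hτ (Nat.zero_le j)
        have h2 := hτ hj
        exact ⟨by linarith [ht.1], by linarith [ht.2]⟩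
    simpa [hk] using key k le_rfl
  · rintro ⟨h, h0, h1⟩
    exact ⟨h0, h1, h.mem, h.continuousOn, h.exists_subdivision⟩

/-- The length of the restriction of `γ` to `[a, b]`, as a real number. -/
def curveLen (γ : ℝ → E) (a b : ℝ) : ℝ := ∫ t in a..b, g.tangentNorm (γ t) (deriv γ t)

theorem curveLen_nonneg (γ : ℝ → E) {a b : ℝ} (hab : a ≤ b) : 0 ≤ g.curveLen γ a b :=
  intervalIntegral.integral_nonneg hab fun _ _ => g.tangentNorm_nonneg _ _

theorem curveLen_congr {γ γ' : ℝ → E} {a b : ℝ} (hab : a ≤ b) (h : EqOn γ γ' (Icc a b)) :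
    g.curveLen γ a b = g.curveLen γ' a b := by
  simp only [curveLen, intervalIntegral.integral_of_le hab, integral_Ioc_eq_integral_Ioo]
  refine setIntegral_congr_fun measurableSet_Ioo fun t ht => ?_
  have h' : γ =ᶠ[𝓝 t] γ' := by
    filter_upwards [Icc_mem_nhds ht.1 ht.2] with s hs using h hs
  simp only [h'.deriv_eq, h'.eq_of_nhds]

theorem curveLen_comp_affine (γ : ℝ → E) {c : ℝ} (hc : 0 ≤ c) (e a b : ℝ) :
    g.curveLen (fun u => γ (c * u + e)) a b = g.curveLen γ (c * a + e) (c * b + e) := by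
  have hd : ∀ u, deriv (fun u => γ (c * u + e)) u = c • deriv γ (c * u + e) := fun u => by
    rw [deriv_comp_mul_left c (fun y => γ (y + e)) u, deriv_comp_add_const]
  simp only [curveLen, hd, tangentNorm_smul, abs_of_nonneg hc,
    intervalIntegral.integral_const_mul]
  exact intervalIntegral.mul_integral_comp_mul_add
    (f := fun t => g.tangentNorm (γ t) (deriv γ t)) c e

theorem curveLen_comp_neg (γ : ℝ → E) (a b : ℝ) :
    g.curveLen (fun u => γ (-u)) (-b) (-a) = g.curveLen γ a b := by
  have hd : ∀ u, g.tangentNorm (γ (-u)) (deriv (fun u => γ (-u)) u)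
      = g.tangentNorm (γ (-u)) (deriv γ (-u)) := fun u => by
    rw [deriv_comp_neg, ← neg_one_smul ℝ (deriv γ (-u)), tangentNorm_smul]
    simp
  simp only [curveLen, hd]
  simpa using intervalIntegral.integral_comp_neg (a := -b) (b := -a)
    (fun t => g.tangentNorm (γ t) (deriv γ t))

/-- The geodesic distance, as a function on the ambient vector space. -/
def pathDist (p q : E) : ENNReal :=
  ⨅ (γ : ℝ → E) (_ : IsPiecewiseSmoothPath U γ p q), g.length γ

theorem pathDist_le_length {γ : ℝ → E} {p q : E} (h : PiecewiseSmoothOn U γ 0 1) (h0 : γ 0 = p)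
    (h1 : γ 1 = q) : g.pathDist p q ≤ g.length γ :=
  iInf₂_le (f := fun γ (_ : IsPiecewiseSmoothPath U γ p q) => g.length γ) γ
    (isPiecewiseSmoothPath_iff.2 ⟨h, h0, h1⟩)

variable [FiniteDimensional ℝ E]

theorem PiecewiseSmoothOn.intervalIntegrable {γ : ℝ → E} {a b : ℝ}
    (h : PiecewiseSmoothOn U γ a b) :
    IntervalIntegrable (fun t => g.tangentNorm (γ t) (deriv γ t)) volume a b := by
  induction h with
  | @smooth a b hab mem h =>
    rcases hab.eq_or_lt with rfl | hlt
    · simp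
    have hc : ContinuousOn (fun t => g.tangentNorm (γ t) (derivWithin γ (Icc a b) t))
        (Icc a b) := by
      have h' := (h.continuousOn_derivWithin (uniqueDiffOn_Icc hlt) (by simp))
      exact g.continuousOn_tangentNorm.comp (h.continuousOn.prodMk h') fun t ht =>
        ⟨mem t ht, mem_univ _⟩
    have hi := hc.intervalIntegrable_of_Icc (μ := volume) hab
    rw [intervalIntegrable_iff_integrableOn_Ioo_of_le hab] at hi ⊢
    refine hi.congr_fun (fun t ht => ?_) measurableSet_Ioo
    simp only [derivWithin_of_mem_nhds (Icc_mem_nhds ht.1 ht.2)]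
  | trans _ _ ih₁ ih₂ => exact ih₁.trans ih₂

theorem PiecewiseSmoothOn.curveLen_add {γ : ℝ → E} {a b c : ℝ}
    (h₁ : PiecewiseSmoothOn U γ a b) (h₂ : PiecewiseSmoothOn U γ b c) :
    g.curveLen γ a b + g.curveLen γ b c = g.curveLen γ a c :=
  intervalIntegral.integral_add_adjacent_intervals (h₁.intervalIntegrable g)
    (h₂.intervalIntegrable g)

theorem PiecewiseSmoothOn.length_eq {γ : ℝ → E} (h : PiecewiseSmoothOn U γ 0 1) :
    g.length γ = ENNReal.ofReal (g.curveLen γ 0 1) := by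
  have hi := (intervalIntegrable_iff_integrableOn_Icc_of_le zero_le_one).1
    (h.intervalIntegrable g)
  rw [curveLen, intervalIntegral.integral_of_le zero_le_one, ← integral_Icc_eq_integral_Ioc,
    ofReal_integral_eq_lintegral_ofReal hi (ae_of_all _ fun _ => g.tangentNorm_nonneg _ _)]
  rfl

/-- Along a curve, the increment of a function is at most the length of the curve times a bound of
its differential with respect to the metric. -/
theorem PiecewiseSmoothOn.norm_sub_le {F : Type*} [NormedAddCommGroup F] [NormedSpace ℝ F]
    {γ : ℝ → E} {a b : ℝ} (h : PiecewiseSmoothOn U γ a b) {f : E → F} {f' : E → E →L[ℝ] F} {C : ℝ}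
    (hf : ∀ t ∈ Icc a b, HasFDerivAt f (f' (γ t)) (γ t))
    (hC : ∀ t ∈ Icc a b, ∀ v, ‖f' (γ t) v‖ ≤ C * g.tangentNorm (γ t) v) :
    ‖f (γ b) - f (γ a)‖ ≤ C * g.curveLen γ a b := by
  induction h with
  | @smooth a b hab mem h =>
    have hi := (PiecewiseSmoothOn.smooth hab mem h).intervalIntegrable g
    rw [curveLen, ← intervalIntegral.integral_const_mul]
    have hd : ∀ t ∈ Ioo a b, HasDerivAt (fun t => f (γ t)) (f' (γ t) (deriv γ t)) t := by
      intro t ht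
      have hγ : DifferentiableAt ℝ γ t :=
        (h.contDiffAt (Icc_mem_nhds ht.1 ht.2)).differentiableAt (by simp)
      exact (hf t (Ioo_subset_Icc_self ht)).comp_hasDerivAt t hγ.hasDerivAt
    refine norm_sub_le_integral_of_norm_deriv_le_of_le (f := fun t => f (γ t)) hab ?_ ?_ ?_
      (hi.const_mul C)
    · exact fun t ht => (hf t ht).continuousAt.comp_continuousWithinAt (h.continuousOn t ht)
    · exact fun t ht => (hd t ht).differentiableAt.differentiableWithinAt
    · refine ae_of_all _ fun t ht => ?_
      rw [(hd t ht).deriv]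
      exact hC t (Ioo_subset_Icc_self ht) _
  | @trans a b c h₁ h₂ ih₁ ih₂ =>
    rw [← h₁.curveLen_add g h₂, mul_add]
    have e₁ := ih₁ (fun t ht => hf t (Icc_subset_Icc_right h₂.le ht))
      fun t ht => hC t (Icc_subset_Icc_right h₂.le ht)
    have e₂ := ih₂ (fun t ht => hf t (Icc_subset_Icc_left h₁.le ht))
      fun t ht => hC t (Icc_subset_Icc_left h₁.le ht)
    have := norm_sub_le_norm_sub_add_norm_sub (f (γ c)) (f (γ b)) (f (γ a))
    linarith

/-! ### The geodesic distance -/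

theorem PiecewiseSmoothOn.pathDist_le {γ : ℝ → E} {a b : ℝ} (h : PiecewiseSmoothOn U γ a b) :
    g.pathDist (γ a) (γ b) ≤ ENNReal.ofReal (g.curveLen γ a b) := by
  rcases h.le.eq_or_lt with rfl | hlt
  · have hc : PiecewiseSmoothOn U (fun _ => γ a) 0 1 :=
      .smooth zero_le_one (fun _ _ => h.left_mem) contDiffOn_const
    refine (g.pathDist_le_length hc rfl rfl).trans ?_
    rw [hc.length_eq g]
    simp [curveLen, tangentNorm_zero]
  · have hc := h.comp_affine (c := b - a) (e := a) (a' := 0) (b' := 1) (sub_pos.2 hlt)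
      (by ring) (by ring)
    refine (g.pathDist_le_length hc (q := γ b) (p := γ a) (by simp) (by simp)).trans ?_
    rw [hc.length_eq g, curveLen_comp_affine g γ (sub_nonneg.2 hlt.le)]
    simp

theorem exists_curveLen_lt {p q : E} {r : ℝ} (h : g.pathDist p q < ENNReal.ofReal r) :
    ∃ γ, PiecewiseSmoothOn U γ 0 1 ∧ γ 0 = p ∧ γ 1 = q ∧ g.curveLen γ 0 1 < r := by
  simp only [pathDist, iInf_lt_iff] at h
  obtain ⟨γ, hγ, h⟩ := h
  obtain ⟨hγ, h0, h1⟩ := isPiecewiseSmoothPath_iff.1 hγ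
  rw [hγ.length_eq g] at h
  exact ⟨γ, hγ, h0, h1, (ENNReal.ofReal_lt_ofReal_iff'.1 h).1⟩

theorem pathDist_self {p : E} (hp : p ∈ U) : g.pathDist p p = 0 := by
  have h : PiecewiseSmoothOn U (fun _ => p) 0 0 := .smooth le_rfl (fun _ _ => hp) contDiffOn_const
  simpa [curveLen] using h.pathDist_le g

theorem pathDist_comm_le (p q : E) : g.pathDist p q ≤ g.pathDist q p := by
  refine le_iInf₂ fun γ hγ' => ?_
  obtain ⟨hγ, rfl, rfl⟩ := isPiecewiseSmoothPath_iff.1 hγ'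
  have h := hγ.comp_neg.pathDist_le g
  rw [curveLen_comp_neg] at h
  rw [hγ.length_eq g]
  simpa using h

theorem pathDist_comm (p q : E) : g.pathDist p q = g.pathDist q p :=
  le_antisymm (g.pathDist_comm_le p q) (g.pathDist_comm_le q p)

theorem pathDist_triangle (p q r : E) : g.pathDist p r ≤ g.pathDist p q + g.pathDist q r := by
  have key : ∀ γ₁, IsPiecewiseSmoothPath U γ₁ p q → ∀ γ₂, IsPiecewiseSmoothPath U γ₂ q r →
      g.pathDist p r ≤ g.length γ₁ + g.length γ₂ := ?_
  · rw [pathDist.eq_def g p q, pathDist.eq_def g q r]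
    simp only [ENNReal.iInf_add, ENNReal.add_iInf]
    exact le_iInf₂ fun γ₂ hγ₂ => le_iInf₂ fun γ₁ hγ₁ => key γ₁ hγ₁ γ₂ hγ₂
  intro γ₁ hγ₁ γ₂ hγ₂
  obtain ⟨h₁, rfl, hq⟩ := isPiecewiseSmoothPath_iff.1 hγ₁
  obtain ⟨h₂, rfl, rfl⟩ := isPiecewiseSmoothPath_iff.1 hγ₂
  let γ : ℝ → E := fun t => if t ≤ 1 then γ₁ t else γ₂ (1 * t + -1)
  have e₁ : EqOn γ γ₁ (Icc 0 1) := fun t ht => if_pos ht.2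
  have e₂ : EqOn γ (fun t => γ₂ (1 * t + -1)) (Icc 1 2) := fun t ht => by
    rcases ht.1.eq_or_lt with rfl | h
    · simp [γ, hq]
    · exact if_neg (not_le.2 h)
  have h₂' := h₂.comp_affine (c := 1) (e := -1) (a' := 1) (b' := 2) one_pos (by ring) (by ring)
  have k₁ := h₁.congr e₁
  have k₂ := h₂'.congr e₂
  have h := (k₁.trans k₂).pathDist_le g
  rw [← k₁.curveLen_add g k₂, g.curveLen_congr k₁.le e₁, g.curveLen_congr k₂.le e₂,
    curveLen_comp_affine g γ₂ zero_le_one,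
    ENNReal.ofReal_add (g.curveLen_nonneg _ zero_le_one) (g.curveLen_nonneg _ (by norm_num))] at h
  rw [h₁.length_eq g, h₂.length_eq g]
  have e0 : γ 0 = γ₁ 0 := if_pos zero_le_one
  have e2 : γ 2 = γ₂ 1 := (if_neg (by norm_num)).trans (by norm_num)
  rw [e0, e2] at h
  norm_num at h
  exact h

end Paths

/-! ### Comparison of the geodesic distance with the norms of the tangent spaces -/

section Local

variable {E : Type*} [NormedAddCommGroup E] [NormedSpace ℝ E] [FiniteDimensional ℝ E]
  {U : TopologicalSpace.Opens E} (g : RiemannianMetricOn U)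

theorem exists_norm_le_tangentNorm {K : Set E} (hK : IsCompact K) (hKU : K ⊆ U) :
    ∃ c > 0, ∀ x ∈ K, ∀ v, ‖v‖ ≤ c * g.tangentNorm x v := by
  have hc : ContinuousOn (fun z : E × E => g.tangentNorm z.1 z.2)
      (K ×ˢ Metric.sphere (0 : E) 1) :=
    g.continuousOn_tangentNorm.mono (prod_mono hKU (subset_univ _))
  have hpos : ∀ z ∈ K ×ˢ Metric.sphere (0 : E) 1, 0 < g.tangentNorm z.1 z.2 := fun z hz =>
    Real.sqrt_pos.2 (g.pos _ (hKU hz.1) _ (ne_zero_of_mem_unit_sphere ⟨z.2, hz.2⟩))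
  obtain ⟨a, ha, h⟩ := (hK.prod (isCompact_sphere (0 : E) 1)).exists_forall_le' hc hpos
  refine ⟨a⁻¹, inv_pos.2 ha, fun x hx v => ?_⟩
  rcases eq_or_ne v 0 with rfl | hv
  · simp [tangentNorm_zero]
  have hv' : 0 < ‖v‖ := norm_pos_iff.2 hv
  have h1 := h (x, ‖v‖⁻¹ • v) ⟨hx, by simp [norm_smul, hv'.ne']⟩
  simp only [tangentNorm_smul, abs_of_pos (inv_pos.2 hv')] at h1
  rw [inv_mul_eq_div, le_div_iff₀ hv'] at h1
  rw [inv_mul_eq_div, le_div_iff₀ ha]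
  linarith

theorem exists_tangentNorm_le_norm {K : Set E} (hK : IsCompact K) (hKU : K ⊆ U) :
    ∃ C > 0, ∀ x ∈ K, ∀ v, g.tangentNorm x v ≤ C * ‖v‖ := by
  obtain ⟨M, hM⟩ := hK.exists_bound_of_continuousOn (f := g.toCLM) (g.continuousOn_toCLM.mono hKU)
  refine ⟨√(max M 1), Real.sqrt_pos.2 (by positivity), fun x hx v => ?_⟩
  refine Real.sqrt_le_iff.2 ⟨by positivity, ?_⟩
  rw [mul_pow, Real.sq_sqrt (by positivity), sq, ← mul_assoc]
  calc g.form x v v = g.toCLM x v v := rfl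
    _ ≤ ‖g.toCLM x v v‖ := le_abs_self _
    _ ≤ ‖g.toCLM x‖ * ‖v‖ * ‖v‖ := (g.toCLM x).le_opNorm₂ v v
    _ ≤ max M 1 * ‖v‖ * ‖v‖ := by gcongr; exact (hM x hx).trans (le_max_left _ _)

/-- Near a compact set, the metric is almost constant. -/
theorem exists_tangentNorm_le_of_near {K : Set E} (hK : IsCompact K) (hKU : K ⊆ U) {η : ℝ}
    (hη : 0 < η) : ∃ δ > 0, ∀ x ∈ K, ∀ y, ‖y - x‖ ≤ δ → y ∈ U ∧ ∀ v,
      g.tangentNorm y v ≤ (1 + η) * g.tangentNorm x v ∧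
      g.tangentNorm x v ≤ (1 + η) * g.tangentNorm y v := by
  obtain ⟨δ₀, hδ₀, hsub⟩ := hK.exists_cthickening_subset_open U.isOpen hKU
  have hK' : IsCompact (Metric.cthickening δ₀ K) := hK.cthickening
  obtain ⟨c, hc, hcn⟩ := g.exists_norm_le_tangentNorm hK' hsub
  have huc := hK'.uniformContinuousOn_of_continuous (f := g.toCLM) (g.continuousOn_toCLM.mono hsub)
  obtain ⟨δ₁, hδ₁, huc⟩ := (Metric.uniformContinuousOn_iff_le (f := g.toCLM)).1 huc (η / c ^ 2)
    (by positivity)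
  -- one half of the estimate, symmetric in the two points
  have key : ∀ x ∈ Metric.cthickening δ₀ K, ∀ y ∈ Metric.cthickening δ₀ K, ‖y - x‖ ≤ δ₁ →
      ∀ v, g.tangentNorm y v ≤ (1 + η) * g.tangentNorm x v := by
    intro x hx y hy hxy v
    have h1 : ‖g.toCLM y - g.toCLM x‖ ≤ η / c ^ 2 :=
      le_of_eq_of_le (dist_eq_norm (g.toCLM y) (g.toCLM x)).symm
        (huc y hy x hx (by rwa [dist_eq_norm]))
    have h2 : g.form y v v - g.form x v v ≤ η / c ^ 2 * ‖v‖ * ‖v‖ :=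
      calc g.form y v v - g.form x v v = (g.toCLM y - g.toCLM x) v v := rfl
        _ ≤ ‖(g.toCLM y - g.toCLM x) v v‖ := le_abs_self _
        _ ≤ ‖g.toCLM y - g.toCLM x‖ * ‖v‖ * ‖v‖ := ContinuousLinearMap.le_opNorm₂ _ v v
        _ ≤ _ := by gcongr
    have h3 := hcn x hx v
    have h4 : ‖v‖ * ‖v‖ ≤ c ^ 2 * g.form x v v := by
      rw [← g.sq_tangentNorm (hsub hx), ← mul_pow, ← sq]
      gcongr
    have h5 : η / c ^ 2 * ‖v‖ * ‖v‖ ≤ η * g.form x v v := by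
      rw [mul_assoc]
      calc η / c ^ 2 * (‖v‖ * ‖v‖) ≤ η / c ^ 2 * (c ^ 2 * g.form x v v) := by gcongr
        _ = η * g.form x v v := by field_simp
    have h6 := g.form_self_nonneg (hsub hx) v
    refine Real.sqrt_le_iff.2 ⟨mul_nonneg (by positivity) (g.tangentNorm_nonneg _ _), ?_⟩
    rw [mul_pow, g.sq_tangentNorm (hsub hx)]
    nlinarith [mul_nonneg (mul_nonneg hη.le hη.le) h6]
  refine ⟨min δ₀ δ₁, lt_min hδ₀ hδ₁, fun x hx y hxy => ?_⟩
  have hx' : x ∈ Metric.cthickening δ₀ K := Metric.self_subset_cthickening K hx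
  have hy' : y ∈ Metric.cthickening δ₀ K :=
    Metric.mem_cthickening_of_dist_le y x δ₀ K hx
      (by rw [dist_eq_norm]; exact hxy.trans (min_le_left _ _))
  have hd := hxy.trans (min_le_right _ _)
  exact ⟨hsub hy', fun v => ⟨key x hx' y hy' hd v,
    key y hy' x hx' (by rwa [norm_sub_rev]) v⟩⟩

/-- Near a compact set, the geodesic distance is at most slightly larger than the distance in the
tangent space. -/
theorem exists_pathDist_le {K : Set E} (hK : IsCompact K) (hKU : K ⊆ U) {η : ℝ} (hη : 0 < η) :
    ∃ δ > 0, ∀ x ∈ K, ∀ y, ‖y - x‖ ≤ δ →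
      y ∈ U ∧ g.pathDist x y ≤ ENNReal.ofReal ((1 + η) * g.tangentNorm x (y - x)) := by
  obtain ⟨δ, hδ, h⟩ := g.exists_tangentNorm_le_of_near hK hKU hη
  refine ⟨δ, hδ, fun x hx y hxy => ⟨(h x hx y hxy).1, ?_⟩⟩
  have hd : ∀ t, HasDerivAt (fun t : ℝ => x + t • (y - x)) (y - x) t := fun t => by
    simpa using ((hasDerivAt_id t).smul_const (y - x)).const_add x
  have hnear : ∀ t ∈ Icc (0 : ℝ) 1, ‖x + t • (y - x) - x‖ ≤ δ := fun t ht => by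
    rw [add_sub_cancel_left, norm_smul, Real.norm_of_nonneg ht.1]
    exact (mul_le_of_le_one_left (norm_nonneg _) ht.2).trans hxy
  have hγ : PiecewiseSmoothOn U (fun t : ℝ => x + t • (y - x)) 0 1 :=
    .smooth zero_le_one (fun t ht => (h x hx _ (hnear t ht)).1) (by fun_prop)
  have h1 := hγ.pathDist_le g
  simp only [zero_smul, add_zero, one_smul, add_sub_cancel] at h1
  refine h1.trans (ENNReal.ofReal_le_ofReal ?_)
  have h2 : g.curveLen (fun t : ℝ => x + t • (y - x)) 0 1
      ≤ ∫ _ in (0 : ℝ)..1, (1 + η) * g.tangentNorm x (y - x) := by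
    refine intervalIntegral.integral_mono_on zero_le_one (hγ.intervalIntegrable g) (by simp)
      fun t ht => ?_
    rw [(hd t).deriv]
    exact ((h x hx _ (hnear t ht)).2 _).1
  simpa using h2

/-- Near a compact set, the distance in the tangent space is at most slightly larger than the
geodesic distance. -/
theorem exists_tangentNorm_sub_le {K : Set E} (hK : IsCompact K) (hKU : K ⊆ U) {η : ℝ}
    (hη : 0 < η) : ∃ δ > 0, ∀ x ∈ K, ∀ y, ∀ r ≤ δ, g.pathDist x y < ENNReal.ofReal r →
      g.tangentNorm x (y - x) ≤ (1 + η) * r := by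
  obtain ⟨δ, hδ, h⟩ := g.exists_tangentNorm_le_of_near hK hKU hη
  obtain ⟨c, hc, hcn⟩ := g.exists_norm_le_tangentNorm hK hKU
  refine ⟨δ / (2 * (c * (1 + η))), by positivity, fun x hx y r hr hxy => ?_⟩
  obtain ⟨γ, hγ, rfl, rfl, hlen⟩ := g.exists_curveLen_lt hxy
  have hr0 : 0 < r := (g.curveLen_nonneg γ zero_le_one).trans_lt hlen
  have key : ∀ t ∈ Icc (0 : ℝ) 1, (∀ s ∈ Icc 0 t, ‖γ s - γ 0‖ ≤ δ) →
      g.tangentNorm (γ 0) (γ t - γ 0) ≤ (1 + η) * r := by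
    intro t ht hs
    have hγt := hγ.restrict le_rfl ht.1 ht.2
    have hγt' := hγ.restrict ht.1 ht.2 le_rfl
    have hlt : g.curveLen γ 0 t ≤ r := by
      have := hγt.curveLen_add g hγt'
      have := g.curveLen_nonneg γ ht.2
      linarith
    set w := γ t - γ 0 with hw
    -- the increment of the linear form `⟨·, w⟩` along the curve is the squared norm of `w`
    have h1 := hγt.norm_sub_le g (f := fun z => g.toCLM (γ 0) w z)
      (f' := fun _ => g.toCLM (γ 0) w) (C := g.tangentNorm (γ 0) w * (1 + η))
      (fun s _ => (g.toCLM (γ 0) w).hasFDerivAt) (fun s hs' v => by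
        have h2 : ∀ v, g.form (γ 0) w v ≤ g.tangentNorm (γ 0) w * (1 + η)
            * g.tangentNorm (γ s) v := fun v => by
          rw [mul_assoc]
          refine (g.form_le_tangentNorm_mul hγ.left_mem w v).trans ?_
          exact mul_le_mul_of_nonneg_left ((h _ hx _ (hs s hs')).2 v).2
            (g.tangentNorm_nonneg _ _)
        refine abs_le.2 ⟨?_, h2 v⟩
        have h3 := h2 (-v)
        rw [map_neg, ← neg_one_smul ℝ v, tangentNorm_smul] at h3
        simp only [abs_neg, abs_one, one_mul] at h3
        rw [toCLM_apply]
        linarith)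
    rw [← map_sub, ← hw, toCLM_apply, ← g.sq_tangentNorm hγ.left_mem, norm_pow,
      Real.norm_of_nonneg (g.tangentNorm_nonneg _ _), sq, mul_assoc] at h1
    rcases (g.tangentNorm_nonneg (γ 0) w).eq_or_lt with h0 | h0
    · rw [← h0]; positivity
    · refine (le_of_mul_le_mul_left h1 h0).trans ?_
      gcongr
  refine key 1 (right_mem_Icc.2 zero_le_one) fun s hs => ?_
  by_contra! hsδ
  -- below, the curve is cut at the first time at which it leaves the ball of radius `δ`
  have hcont : ContinuousOn (fun s => ‖γ s - γ 0‖) (Icc 0 1) :=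
    (hγ.continuousOn.sub continuousOn_const).norm
  have hivt : ∀ s ∈ Icc (0 : ℝ) 1, δ < ‖γ s - γ 0‖ → ∃ t ∈ Icc 0 s, ‖γ t - γ 0‖ = δ := by
    intro s hs hsδ
    exact intermediate_value_Icc hs.1 (hcont.mono (Icc_subset_Icc_right hs.2))
      ⟨by simpa using hδ.le, hsδ.le⟩
  have hTc : IsCompact {t ∈ Icc (0 : ℝ) 1 | ‖γ t - γ 0‖ = δ} :=
    isCompact_Icc.of_isClosed_subset (hcont.preimage_isClosed_of_isClosed isClosed_Icc
      (isClosed_singleton (x := δ))) fun t ht => ht.1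
  obtain ⟨t₀, ht₀, ht₀δ⟩ := hivt s hs hsδ
  obtain ⟨t, ⟨ht, htδ⟩, hmin⟩ := hTc.exists_isLeast
    ⟨t₀, ⟨ht₀.1, ht₀.2.trans hs.2⟩, ht₀δ⟩
  have h1 := key t ht fun u hu => by
    by_contra! huδ
    obtain ⟨u', hu', hu'δ⟩ := hivt u ⟨hu.1, hu.2.trans ht.2⟩ huδ
    have hle : t ≤ u' := hmin ⟨⟨hu'.1, hu'.2.trans (hu.2.trans ht.2)⟩, hu'δ⟩
    have : u = t := le_antisymm hu.2 (hle.trans hu'.2)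
    rw [this] at huδ
    exact huδ.ne' htδ
  have h2 := hcn _ hx (γ t - γ 0)
  have h3 : c * g.tangentNorm (γ 0) (γ t - γ 0) ≤ c * ((1 + η) * r) := by gcongr
  have h4 : c * ((1 + η) * r) ≤ c * ((1 + η) * (δ / (2 * (c * (1 + η))))) := by gcongr
  have h5 : c * ((1 + η) * (δ / (2 * (c * (1 + η))))) = δ / 2 := by field_simp
  linarith

theorem eq_of_pathDist_eq_zero {p q : E} (hp : p ∈ U) (h : g.pathDist p q = 0) : p = q := by
  obtain ⟨δ, hδ, hL⟩ := g.exists_tangentNorm_sub_le (isCompact_singleton (x := p))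
    (singleton_subset_iff.2 hp) one_pos
  have h1 : g.tangentNorm p (q - p) ≤ 0 := by
    refine le_of_forall_pos_le_add fun ε hε => ?_
    have := hL p rfl q (min δ (ε / 2)) (min_le_left _ _)
      (by rw [h, ENNReal.ofReal_pos]; positivity)
    have := min_le_right δ (ε / 2)
    linarith
  by_contra hne
  exact (Real.sqrt_pos.2 (g.pos p hp _ (sub_ne_zero.2 (Ne.symm hne)))).not_ge h1

/-! ### Metric completeness -/

/-- The metric is proper if bounded sets for the geodesic distance are contained in compact subsets
of `U`. -/
def IsProper : Prop :=
  ∀ p ∈ U, ∀ R : ℝ, ∃ K ⊆ (U : Set E), IsCompact K ∧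
    ∀ q, g.pathDist p q ≤ ENNReal.ofReal R → q ∈ K

variable {g}

theorem IsProper.completeSpace (hg : g.IsProper) {X : Type*} [MetricSpace X] (f : X → E)
    (hf : range f = U) (hdist : ∀ x y, edist x y = g.pathDist (f x) (f y)) : CompleteSpace X := by
  have hfU : ∀ x, f x ∈ U := fun x => (hf ▸ mem_range_self x : f x ∈ (U : Set E))
  refine Metric.complete_of_cauchySeq_tendsto fun u hu => ?_
  obtain ⟨R, hR⟩ := (Metric.isBounded_iff_subset_closedBall (u 0)).1 hu.isBounded_range
  obtain ⟨K, hKU, hK, hball⟩ := hg (f (u 0)) (hfU _) R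
  have hmem : ∀ k, f (u k) ∈ K := fun k => hball _ <| by
    have h1 := hR (mem_range_self k)
    rw [Metric.mem_closedBall, dist_comm] at h1
    rw [← hdist, edist_dist]
    exact ENNReal.ofReal_le_ofReal h1
  obtain ⟨x, hx, φ, hφ, hlim⟩ := hK.tendsto_subseq hmem
  obtain ⟨z, rfl⟩ : x ∈ range f := hf ▸ hKU hx
  refine ⟨z, tendsto_nhds_of_cauchySeq_of_subseq hu hφ.tendsto_atTop ?_⟩
  obtain ⟨δ, hδ, hU⟩ := g.exists_pathDist_le (isCompact_singleton (x := f z))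
    (singleton_subset_iff.2 (hKU hx)) one_pos
  rw [tendsto_iff_edist_tendsto_0]
  have hlim' : Tendsto (fun k => f (u (φ k)) - f z) atTop (𝓝 0) := by
    simpa using hlim.sub_const (f z)
  have hcont : Continuous fun v : E => ENNReal.ofReal ((1 + 1) * g.tangentNorm (f z) v) := by
    refine ENNReal.continuous_ofReal.comp (continuous_const.mul ?_)
    exact (((g.toCLM (f z)).continuous).clm_apply continuous_id).sqrt
  have h0 := (hcont.tendsto 0).comp hlim'
  simp only [tangentNorm_zero, mul_zero, ENNReal.ofReal_zero] at h0
  refine tendsto_of_tendsto_of_tendsto_of_le_of_le' tendsto_const_nhds h0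
    (Eventually.of_forall fun _ => zero_le) ?_
  have hev : ∀ᶠ k in atTop, ‖f (u (φ k)) - f z‖ < δ := by
    have := hlim'.norm
    rw [norm_zero] at this
    exact this.eventually_lt_const hδ
  filter_upwards [hev] with k hk
  rw [edist_comm, hdist]
  exact (hU (f z) rfl _ hk.le).2

theorem IsProper.metricallyComplete (hg : g.IsProper)
    (hconn : ∀ p ∈ U, ∀ q ∈ U, g.pathDist p q ≠ ⊤) : g.MetricallyComplete := by
  let M : MetricSpace U :=
    { dist := fun p q => (g.pathDist p q).toReal
      edist := fun p q => g.pathDist p q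
      dist_self := fun p => by simp [g.pathDist_self p.2]
      dist_comm := fun p q => by rw [g.pathDist_comm]
      dist_triangle := fun p q r => by
        rw [← ENNReal.toReal_add (hconn p p.2 q q.2) (hconn q q.2 r r.2)]
        exact ENNReal.toReal_mono
          (ENNReal.add_ne_top.2 ⟨hconn p p.2 q q.2, hconn q q.2 r r.2⟩)
          (g.pathDist_triangle p q r)
      edist_dist := fun p q => (ENNReal.ofReal_toReal (hconn p p.2 q q.2)).symm
      eq_of_dist_eq_zero := fun {p q} h => Subtype.ext <| g.eq_of_pathDist_eq_zero p.2 <|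
        ((ENNReal.toReal_eq_zero_iff _).1 h).resolve_right (hconn p p.2 q q.2) }
  exact ⟨M, fun p q => rfl,
    @IsProper.completeSpace E _ _ _ U g hg U M Subtype.val Subtype.range_coe fun _ _ => rfl⟩

end Local

end RiemannianMetricOn

/-! ### Ordinary differential equations: a solution that stays in compact sets is global -/

section ODE

variable {F : Type*} [NormedAddCommGroup F] [NormedSpace ℝ F] [FiniteDimensional ℝ F]
  {Ω : Set F} {X : F → F}

/-- A smooth vector field on an open set agrees near a given compact subset with a bounded and
Lipschitz vector field on the whole space. -/
theorem exists_lipschitzWith_eventuallyEq_nhdsSet (hΩ : IsOpen Ω) (hX : ContDiffOn ℝ ∞ X Ω)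
    {K : Set F} (hK : IsCompact K) (hKΩ : K ⊆ Ω) :
    ∃ (Y : F → F) (L B : NNReal), LipschitzWith L Y ∧ (∀ z, ‖Y z‖ ≤ B) ∧
      ∀ᶠ z in 𝓝ˢ K, Y z = X z := by
  obtain ⟨K', hK', hKK', hK'Ω⟩ := exists_compact_between hK hΩ hKΩ
  obtain ⟨f, hf1, hf0, -⟩ := exists_contMDiffMap_one_nhds_of_subset_interior
    (modelWithCornersSelf ℝ F) (n := ⊤) hK.isClosed hKK'
  have hf : ContDiff ℝ ∞ f := f.contMDiff.contDiff
  have hsupp : ∀ z ∉ K', f z • X z = 0 := fun z hz => by rw [hf0 z hz, zero_smul]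
  have hY : ContDiff ℝ ∞ fun z => f z • X z := by
    rw [contDiff_iff_contDiffAt]
    intro z
    by_cases hz : z ∈ Ω
    · exact hf.contDiffAt.smul (hX.contDiffAt (hΩ.mem_nhds hz))
    · refine (contDiffAt_const (c := (0 : F))).congr_of_eventuallyEq ?_
      filter_upwards [hK'.isClosed.isOpen_compl.mem_nhds fun h => hz (hK'Ω h)] with y hy
      exact hsupp y hy
  have hcs : HasCompactSupport fun z => f z • X z := HasCompactSupport.intro hK' hsupp
  obtain ⟨L, hL⟩ := hY.lipschitzWith_of_hasCompactSupport hcs (by simp)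
  obtain ⟨B, hB⟩ := hcs.exists_bound_of_continuous hY.continuous
  refine ⟨_, L, ⟨max B 0, le_max_right _ _⟩, hL, fun z => (hB z).trans (le_max_left _ _), ?_⟩
  filter_upwards [hf1] with z hz
  rw [hz, one_smul]

theorem exists_hasDerivWithinAt_of_lipschitzWith {Y : F → F} {L B : NNReal}
    (hL : LipschitzWith L Y) (hB : ∀ z, ‖Y z‖ ≤ B) (z₀ : F) {T : ℝ} (hT : 0 ≤ T) :
    ∃ y : ℝ → F, y 0 = z₀ ∧ ∀ t ∈ Icc (-T) T, HasDerivWithinAt y (Y (y t)) (Icc (-T) T) t := by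
  have hmem : (0 : ℝ) ∈ Icc (-T) T := ⟨by linarith, hT⟩
  exact (IsPicardLindelof.of_time_independent (t₀ := ⟨0, hmem⟩) (x₀ := z₀)
    (a := B * T.toNNReal) (r := 0) (fun z _ => hB z) hL.lipschitzOnWith
    (by simp [hT])).exists_eq_forall_mem_Icc_hasDerivWithinAt₀

/-- If all solutions with initial value `z₀` on subintervals of `(-T, T)` stay in a compact subset of
the domain, then there is a solution on `(-T, T)`: solve the equation for a Lipschitz vector field
that agrees with the given one near the compact set. -/
theorem exists_hasDerivAt_Ioo_of_mem_compact (hΩ : IsOpen Ω) (hX : ContDiffOn ℝ ∞ X Ω) {z₀ : F}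
    {T : ℝ} (hT : 0 < T) {K : Set F} (hK : IsCompact K) (hKΩ : K ⊆ Ω) (hz₀ : z₀ ∈ K)
    (h : ∀ a ∈ Ioc 0 T, ∀ y : ℝ → F, y 0 = z₀ →
      (∀ t ∈ Ioo (-a) a, y t ∈ Ω ∧ HasDerivAt y (X (y t)) t) → ∀ t ∈ Ioo (-a) a, y t ∈ K) :
    ∃ y : ℝ → F, y 0 = z₀ ∧ ∀ t ∈ Ioo (-T) T, y t ∈ Ω ∧ HasDerivAt y (X (y t)) t := by
  obtain ⟨Y, L, B, hL, hB, hYX⟩ := exists_lipschitzWith_eventuallyEq_nhdsSet hΩ hX hK hKΩ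
  obtain ⟨V, hV, hKV, hVYX⟩ := eventually_nhdsSet_iff_exists.1
    (hYX.and (hΩ.mem_nhdsSet.2 hKΩ))
  obtain ⟨y, hy0, hy⟩ := exists_hasDerivWithinAt_of_lipschitzWith hL hB z₀ hT.le
  have hcont : ContinuousOn y (Icc (-T) T) := fun t ht => (hy t ht).continuousWithinAt
  have hsol : ∀ t ∈ Ioo (-T) T, y t ∈ V → y t ∈ Ω ∧ HasDerivAt y (X (y t)) t := by
    intro t ht htV
    obtain ⟨h1, h2⟩ := hVYX _ htV
    refine ⟨h2, ?_⟩
    rw [← h1]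
    exact (hy t (Ioo_subset_Icc_self ht)).hasDerivAt (Icc_mem_nhds ht.1 ht.2)
  -- it never leaves `V`: look at the first time, in absolute value, at which it would
  have hbad : ∀ s ∈ Icc 0 T, y s ∈ V ∧ y (-s) ∈ V := by
    have hneg : ContinuousOn (fun s => y (-s)) (Icc 0 T) :=
      hcont.comp continuousOn_neg fun s hs =>
        ⟨by linarith [hs.2], by linarith [hs.1]⟩
    have hpos : ContinuousOn y (Icc 0 T) := hcont.mono (Icc_subset_Icc_left (by linarith))
    have hc : IsCompact ((Icc 0 T ∩ y ⁻¹' Vᶜ) ∪ (Icc 0 T ∩ (fun s => y (-s)) ⁻¹' Vᶜ)) :=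
      (isCompact_Icc.of_isClosed_subset (hpos.preimage_isClosed_of_isClosed isClosed_Icc
        hV.isClosed_compl) inter_subset_left).union
      (isCompact_Icc.of_isClosed_subset (hneg.preimage_isClosed_of_isClosed isClosed_Icc
        hV.isClosed_compl) inter_subset_left)
    by_contra! hcon
    obtain ⟨s, hs, hsV⟩ := hcon
    have hne : ((Icc 0 T ∩ y ⁻¹' Vᶜ) ∪ (Icc 0 T ∩ (fun s => y (-s)) ⁻¹' Vᶜ)).Nonempty := by
      by_cases h1 : y s ∈ V
      · exact ⟨s, Or.inr ⟨hs, hsV h1⟩⟩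
      · exact ⟨s, Or.inl ⟨hs, h1⟩⟩
    obtain ⟨a, ha, hmin⟩ := hc.exists_isLeast hne
    have haT : a ∈ Icc 0 T := by rcases ha with ha | ha <;> exact ha.1
    have hcl : y a ∈ K ∧ y (-a) ∈ K := by
      rcases haT.1.eq_or_lt with rfl | ha0
      · simpa [hy0] using hz₀
      have hin : ∀ t ∈ Ioo (-a) a, y t ∈ K := by
        refine h a ⟨ha0, haT.2⟩ y hy0 fun t ht => hsol t ⟨by linarith [ht.1, haT.2],
          by linarith [ht.2, haT.2]⟩ ?_
        by_contra htV
        rcases le_total 0 t with h0 | h0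
        · exact ht.2.not_ge (hmin (Or.inl ⟨⟨h0, by linarith [ht.2, haT.2]⟩, htV⟩))
        · have h1 := hmin (Or.inr ⟨⟨neg_nonneg.2 h0, by linarith [ht.1, haT.2]⟩,
            by simpa using htV⟩)
          linarith [ht.1]
      have hclo : closure (Ioo (-a) a) = Icc (-a) a := closure_Ioo (by linarith)
      have himg : ∀ t ∈ Icc (-a) a, y t ∈ K := by
        have h1 := ContinuousOn.image_closure (s := Ioo (-a) a) (f := y) (by
          rw [hclo]; exact hcont.mono (Icc_subset_Icc (by linarith [haT.2]) haT.2))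
        rw [hclo] at h1
        intro t ht
        exact closure_minimal (image_subset_iff.2 hin) hK.isClosed (h1 (mem_image_of_mem y ht))
      exact ⟨himg a ⟨by linarith, le_rfl⟩, himg (-a) ⟨le_rfl, by linarith⟩⟩
    rcases ha with ha | ha
    exacts [ha.2 (hKV hcl.1), ha.2 (hKV hcl.2)]
  refine ⟨y, hy0, fun t ht => hsol t ht ?_⟩
  rcases le_total 0 t with h0 | h0
  · exact (hbad t ⟨h0, ht.2.le⟩).1
  · simpa using (hbad (-t) ⟨neg_nonneg.2 h0, by linarith [ht.1]⟩).2

/-- If all solutions of an autonomous equation with initial value `z₀` stay, within any bounded time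
interval, in a compact subset of the domain, then there is a solution defined for all times. -/
theorem exists_hasDerivAt_of_forall_mem_compact (hΩ : IsOpen Ω) (hX : ContDiffOn ℝ ∞ X Ω)
    {z₀ : F} (h : ∀ T > 0, ∃ K ⊆ Ω, IsCompact K ∧ z₀ ∈ K ∧
      ∀ a ∈ Ioc 0 T, ∀ y : ℝ → F, y 0 = z₀ →
      (∀ t ∈ Ioo (-a) a, y t ∈ Ω ∧ HasDerivAt y (X (y t)) t) → ∀ t ∈ Ioo (-a) a, y t ∈ K) :
    ∃ z : ℝ → F, z 0 = z₀ ∧ ∀ t, z t ∈ Ω ∧ HasDerivAt z (X (z t)) t := by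
  have hex : ∀ T > 0, ∃ y : ℝ → F, y 0 = z₀ ∧
      ∀ t ∈ Ioo (-T) T, y t ∈ Ω ∧ HasDerivAt y (X (y t)) t := fun T hT => by
    obtain ⟨K, hKΩ, hK, hz₀, hK'⟩ := h T hT
    exact exists_hasDerivAt_Ioo_of_mem_compact hΩ hX hT hK hKΩ hz₀ hK'
  choose y hy0 hy using hex
  -- solutions on nested intervals agree, so that they can be glued
  have hy' : ∀ S (hS : 0 < S) T (hT : 0 < T), S ≤ T → EqOn (y S hS) (y T hT) (Ioo (-S) S) := by
    intro S hS T hT hST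
    obtain ⟨K, hKΩ, hK, -, hK'⟩ := h T hT
    obtain ⟨Y, L, B, hL, hB, hYX⟩ := exists_lipschitzWith_eventuallyEq_nhdsSet hΩ hX hK hKΩ
    have hsub : Ioo (-S) S ⊆ Ioo (-T) T := Ioo_subset_Ioo (by linarith) hST
    have k₁ := hK' S ⟨hS, hST⟩ (y S hS) (hy0 S hS) (hy S hS)
    have k₂ := hK' T ⟨hT, le_rfl⟩ (y T hT) (hy0 T hT) (hy T hT)
    refine ODE_solution_unique_of_mem_Ioo (v := fun _ => Y) (s := fun _ => univ) (K := L)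
      (t₀ := 0) (fun t _ => hL.lipschitzOnWith) ⟨by linarith, hS⟩ (fun t ht => ⟨?_, mem_univ _⟩)
      (fun t ht => ⟨?_, mem_univ _⟩) (by rw [hy0, hy0])
    · rw [hYX.self_of_nhdsSet _ (k₁ t ht)]
      exact (hy S hS t ht).2
    · rw [hYX.self_of_nhdsSet _ (k₂ t (hsub ht))]
      exact (hy T hT t (hsub ht)).2
  have hpos : ∀ t : ℝ, 0 < |t| + 1 := fun t => by positivity
  have hloc : ∀ t₀ : ℝ, ∀ t ∈ Ioo (t₀ - 1) (t₀ + 1),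
      y (|t| + 1) (hpos t) t = y (|t₀| + 2) (by positivity) t := by
    intro t₀ t ht
    have h1 : |t - t₀| < 1 := abs_lt.2 ⟨by linarith [ht.1], by linarith [ht.2]⟩
    have h2 := abs_sub_abs_le_abs_sub t t₀
    refine hy' _ _ _ _ (by linarith) (abs_lt.1 (by linarith))
  refine ⟨fun t => y (|t| + 1) (hpos t) t, hy0 _ _, fun t₀ => ?_⟩
  have hmem : t₀ ∈ Ioo (-(|t₀| + 2)) (|t₀| + 2) := abs_lt.1 (by linarith)
  have hev : (fun t => y (|t| + 1) (hpos t) t) =ᶠ[𝓝 t₀] y (|t₀| + 2) (by positivity) := by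
    filter_upwards [Ioo_mem_nhds (sub_one_lt t₀) (lt_add_one t₀)] with t ht using hloc t₀ t ht
  obtain ⟨h1, h2⟩ := hy (|t₀| + 2) (by positivity) t₀ hmem
  have heq := hev.eq_of_nhds
  refine ⟨by rwa [← heq] at h1, ?_⟩
  rw [← heq] at h2
  exact h2.congr_of_eventuallyEq hev

omit [FiniteDimensional ℝ F] in
theorem contDiffOn_Icc_of_hasDerivWithinAt [CompleteSpace F] (hX : ContDiffOn ℝ ∞ X Ω) {a b : ℝ}
    {z : ℝ → F} (hz : ∀ t ∈ Icc a b, z t ∈ Ω ∧ HasDerivAt z (X (z t)) t) :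
    ContDiffOn ℝ ∞ z (Icc a b) :=
  ODE.contDiffOn_enat_Icc_of_hasDerivWithinAt (n := ⊤) (f := fun _ => X) (u := Ω)
    (hX.comp contDiffOn_snd fun _ hz => hz.2) (fun t ht => (hz t ht).2.hasDerivWithinAt)
    fun t ht => (hz t ht).1

end ODE

namespace RiemannianMetricOn

/-! ### Geodesics as solutions of the Hamiltonian equations -/

section Hamiltonian

set_option maxSynthPendingDepth 4

variable {E : Type*} [NormedAddCommGroup E] [NormedSpace ℝ E] [FiniteDimensional ℝ E]
  {U : TopologicalSpace.Opens E} (g : RiemannianMetricOn U)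

theorem exists_equiv_eq_toCLM {x : E} (hx : x ∈ U) :
    ∃ e : E ≃L[ℝ] (E →L[ℝ] ℝ), (e : E →L[ℝ] E →L[ℝ] ℝ) = g.toCLM x := by
  have hinj : Function.Injective (g.toCLM x : E →ₗ[ℝ] E →L[ℝ] ℝ) := by
    rw [injective_iff_map_eq_zero]
    intro v hv
    by_contra hne
    have h1 := g.pos x hx v hne
    rw [← toCLM_apply] at h1
    have h2 : g.toCLM x v = 0 := hv
    simp [h2] at h1
  have hdim : Module.finrank ℝ E = Module.finrank ℝ (E →L[ℝ] ℝ) := by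
    rw [← (LinearMap.toContinuousLinearMap : (E →ₗ[ℝ] ℝ) ≃ₗ[ℝ] E →L[ℝ] ℝ).finrank_eq]
    exact (Subspace.dual_finrank_eq (K := ℝ) (V := E)).symm
  refine ⟨(LinearEquiv.ofInjectiveOfFinrankEq _ hinj hdim).toContinuousLinearEquiv, ?_⟩
  ext v w
  rfl

/-- The musical isomorphism from covectors to vectors at the point `x`. It has a junk value for `x`
outside `U`. -/
def sharp (x : E) : (E →L[ℝ] ℝ) →L[ℝ] E := (g.toCLM x).inverse

theorem toCLM_sharp {x : E} (hx : x ∈ U) (P : E →L[ℝ] ℝ) : g.toCLM x (g.sharp x P) = P := by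
  obtain ⟨e, he⟩ := g.exists_equiv_eq_toCLM hx
  rw [sharp, ← he, ContinuousLinearMap.inverse_equiv]
  exact e.apply_symm_apply P

theorem sharp_toCLM {x : E} (hx : x ∈ U) (v : E) : g.sharp x (g.toCLM x v) = v := by
  obtain ⟨e, he⟩ := g.exists_equiv_eq_toCLM hx
  rw [sharp, ← he, ContinuousLinearMap.inverse_equiv]
  exact e.symm_apply_apply v

theorem contDiffOn_sharp : ContDiffOn ℝ ∞ g.sharp U := by
  intro x hx
  obtain ⟨e, he⟩ := g.exists_equiv_eq_toCLM hx
  have h1 : ContDiffAt ℝ ∞ ContinuousLinearMap.inverse (g.toCLM x) := by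
    rw [← he]
    exact contDiffAt_map_inverse e
  exact h1.comp_contDiffWithinAt x (g.contDiffOn_toCLM x hx)

/-- The covector `w ↦ ∂_w g(v, v)`. -/
def gradForm (x v : E) : E →L[ℝ] ℝ := ((fderiv ℝ g.toCLM x).flip v).flip v

@[simp]
theorem gradForm_apply (x v w : E) : g.gradForm x v w = fderiv ℝ g.toCLM x w v v := rfl

/-- The Hamiltonian vector field of the kinetic energy on the cotangent bundle `U × E*`. -/
def hamiltonianField (z : E × (E →L[ℝ] ℝ)) : E × (E →L[ℝ] ℝ) :=
  (g.sharp z.1 z.2, (1 / 2 : ℝ) • g.gradForm z.1 (g.sharp z.1 z.2))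

/-- The cotangent bundle of `U`. -/
def cotangent (U : TopologicalSpace.Opens E) : Set (E × (E →L[ℝ] ℝ)) := (U : Set E) ×ˢ univ

omit [FiniteDimensional ℝ E] in
theorem isOpen_cotangent : IsOpen (cotangent U) := U.isOpen.prod isOpen_univ

theorem contDiffOn_velocity :
    ContDiffOn ℝ ∞ (fun z : E × (E →L[ℝ] ℝ) => g.sharp z.1 z.2) (cotangent U) :=
  (g.contDiffOn_sharp.comp contDiffOn_fst fun _ hz => hz.1).clm_apply contDiffOn_snd

theorem contDiffOn_hamiltonianField : ContDiffOn ℝ ∞ g.hamiltonianField (cotangent U) := by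
  have h1 : ContDiffOn ℝ ∞ (fderiv ℝ g.toCLM) U :=
    g.contDiffOn_toCLM.fderiv_of_isOpen U.isOpen (by simp)
  have h2 : ContDiffOn ℝ ∞ (fun z : E × (E →L[ℝ] ℝ) => fderiv ℝ g.toCLM z.1) (cotangent U) :=
    h1.comp contDiffOn_fst fun _ hz => hz.1
  have h3 : ContDiffOn ℝ ∞ (fun z : E × (E →L[ℝ] ℝ) => g.gradForm z.1 (g.sharp z.1 z.2))
      (cotangent U) :=
    contDiffOn_clm_apply.2 fun w => ((h2.clm_apply contDiffOn_const).clm_apply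
      g.contDiffOn_velocity).clm_apply g.contDiffOn_velocity
  exact g.contDiffOn_velocity.prodMk (h3.const_smul (1 / 2 : ℝ))

theorem hasFDerivAt_toCLM {x : E} (hx : x ∈ U) :
    HasFDerivAt g.toCLM (fderiv ℝ g.toCLM x) x :=
  ((g.contDiffOn_toCLM.contDiffAt (U.isOpen.mem_nhds hx)).differentiableAt (by simp)).hasFDerivAt

theorem fderiv_form {x : E} (hx : x ∈ U) (u v w : E) :
    fderiv ℝ (fun y => g.form y v w) x u = fderiv ℝ g.toCLM x u v w := by
  have h := ((g.hasFDerivAt_toCLM hx).clm_apply (hasFDerivAt_const v x)).clm_apply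
    (hasFDerivAt_const w x)
  rw [show (fun y => g.form y v w) = fun y => g.toCLM y v w from rfl, h.fderiv]
  simp

theorem christoffel_self {x : E} (hx : x ∈ U) (v w : E) :
    g.christoffel x v v w
      = fderiv ℝ g.toCLM x v v w - 1 / 2 * fderiv ℝ g.toCLM x w v v := by
  simp only [christoffel, g.fderiv_form hx]
  ring

variable {g}

theorem hasDerivAt_fst_of_hamiltonian {z : ℝ → E × (E →L[ℝ] ℝ)} {t : ℝ}
    (hz : HasDerivAt z (g.hamiltonianField (z t)) t) :
    HasDerivAt (fun s => (z s).1) (g.sharp (z t).1 (z t).2) t :=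
  hz.fst

/-- Along a solution of the Hamiltonian equations, the velocity has a derivative that solves the
geodesic equation, and the kinetic energy is constant. -/
theorem exists_hasDerivAt_velocity {z : ℝ → E × (E →L[ℝ] ℝ)} {t : ℝ} (hzU : z t ∈ cotangent U)
    (hz : HasDerivAt z (g.hamiltonianField (z t)) t) (hev : ∀ᶠ s in 𝓝 t, z s ∈ cotangent U) :
    ∃ a : E, HasDerivAt (fun s => g.sharp (z s).1 (z s).2) a t ∧
      (∀ w, g.form (z t).1 a w
        + g.christoffel (z t).1 (g.sharp (z t).1 (z t).2) (g.sharp (z t).1 (z t).2) w = 0) ∧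
      HasDerivAt (fun s => g.form (z s).1 (g.sharp (z s).1 (z s).2) (g.sharp (z s).1 (z s).2))
        0 t := by
  have hv : DifferentiableAt ℝ (fun s => g.sharp (z s).1 (z s).2) t :=
    ((g.contDiffOn_velocity.contDiffAt (isOpen_cotangent.mem_nhds hzU)).differentiableAt
      (by simp)).comp t hz.differentiableAt
  set v := fun s => g.sharp (z s).1 (z s).2 with hvdef
  have h1 : HasDerivAt (fun s => (z s).1) (v t) t := hasDerivAt_fst_of_hamiltonian hz
  have h2 : HasDerivAt (fun s => (z s).2) ((1 / 2 : ℝ) • g.gradForm (z t).1 (v t)) t := hz.snd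
  have hG : HasDerivAt (fun s => g.toCLM (z s).1) (fderiv ℝ g.toCLM (z t).1 (v t)) t :=
    HasFDerivAt.comp_hasDerivAt (l := g.toCLM) t (g.hasFDerivAt_toCLM hzU.1) h1
  have hP := hG.clm_apply hv.hasDerivAt
  have hP' := hP.clm_apply hv.hasDerivAt
  have heq : (fun s => g.toCLM (z s).1 (v s)) =ᶠ[𝓝 t] fun s => (z s).2 := by
    filter_upwards [hev] with s hs using g.toCLM_sharp hs.1 _
  -- the derivative of the momentum `g(v, ·)` in two ways
  have hkey : ∀ w, fderiv ℝ g.toCLM (z t).1 (v t) (v t) w + g.form (z t).1 (deriv v t) w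
      = 1 / 2 * fderiv ℝ g.toCLM (z t).1 w (v t) (v t) := fun w =>
    congrArg (fun φ : E →L[ℝ] ℝ => φ w) (hP.unique (h2.congr_of_eventuallyEq heq))
  refine ⟨deriv v t, hv.hasDerivAt, fun w => ?_, ?_⟩
  · rw [g.christoffel_self hzU.1]
    linarith [hkey w]
  · have h3 := hkey (v t)
    have h4 := g.symm _ hzU.1 (v t) (deriv v t)
    refine hP'.congr_deriv ?_
    change fderiv ℝ g.toCLM (z t).1 (v t) (v t) (v t) + g.form (z t).1 (deriv v t) (v t)
      + g.form (z t).1 (v t) (deriv v t) = 0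
    linarith

theorem form_velocity_eq {z : ℝ → E × (E →L[ℝ] ℝ)} {J : Set ℝ} (hJ : IsOpen J)
    (hJc : IsPreconnected J)
    (hz : ∀ t ∈ J, z t ∈ cotangent U ∧ HasDerivAt z (g.hamiltonianField (z t)) t) {s t : ℝ}
    (hs : s ∈ J) (ht : t ∈ J) :
    g.form (z s).1 (g.sharp (z s).1 (z s).2) (g.sharp (z s).1 (z s).2)
      = g.form (z t).1 (g.sharp (z t).1 (z t).2) (g.sharp (z t).1 (z t).2) := by
  have hd : ∀ r ∈ J, HasDerivAt
      (fun s => g.form (z s).1 (g.sharp (z s).1 (z s).2) (g.sharp (z s).1 (z s).2)) 0 r := by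
    intro r hr
    obtain ⟨a, -, -, h⟩ := exists_hasDerivAt_velocity (hz r hr).1 (hz r hr).2
      (by filter_upwards [hJ.mem_nhds hr] with s hs using (hz s hs).1)
    exact h
  exact hJ.is_const_of_deriv_eq_zero hJc
    (fun r hr => (hd r hr).differentiableAt.differentiableWithinAt)
    (fun r hr => (hd r hr).deriv) hs ht

theorem contDiffOn_fst_of_hamiltonian {z : ℝ → E × (E →L[ℝ] ℝ)} {a b : ℝ}
    (hz : ∀ t ∈ Icc a b, z t ∈ cotangent U ∧ HasDerivAt z (g.hamiltonianField (z t)) t) :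
    ContDiffOn ℝ ∞ (fun t => (z t).1) (Icc a b) :=
  contDiff_fst.comp_contDiffOn (contDiffOn_Icc_of_hasDerivWithinAt g.contDiffOn_hamiltonianField hz)

theorem isGeodesicOn_of_hamiltonian {z : ℝ → E × (E →L[ℝ] ℝ)}
    (hz : ∀ t, z t ∈ cotangent U ∧ HasDerivAt z (g.hamiltonianField (z t)) t) {J : Set ℝ}
    (hJ : UniqueDiffOn ℝ J) : g.IsGeodesicOn (fun t => (z t).1) J := by
  have hd : ∀ t ∈ J, derivWithin (fun t => (z t).1) J t = g.sharp (z t).1 (z t).2 := fun t ht =>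
    (hasDerivAt_fst_of_hamiltonian (hz t).2).hasDerivWithinAt.derivWithin (hJ t ht)
  refine ⟨fun t _ => (hz t).1.1, ?_, fun t ht w => ?_⟩
  · refine ContDiff.contDiffOn (contDiff_iff_contDiffAt.2 fun t => ?_)
    exact (contDiffOn_fst_of_hamiltonian (a := t - 1) (b := t + 1) fun s _ => hz s).contDiffAt
      (Icc_mem_nhds (by linarith) (by linarith))
  · obtain ⟨a, ha, heq, -⟩ := exists_hasDerivAt_velocity (hz t).1 (hz t).2
      (Eventually.of_forall fun s => (hz s).1)
    rw [derivWithin_congr hd (hd t ht), ha.hasDerivWithinAt.derivWithin (hJ t ht), hd t ht]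
    exact heq w

theorem piecewiseSmoothOn_of_hamiltonian {z : ℝ → E × (E →L[ℝ] ℝ)} {a b : ℝ} (hab : a ≤ b)
    (hz : ∀ t ∈ Icc a b, z t ∈ cotangent U ∧ HasDerivAt z (g.hamiltonianField (z t)) t) :
    PiecewiseSmoothOn U (fun t => (z t).1) a b :=
  .smooth hab (fun t ht => (hz t ht).1.1) (contDiffOn_fst_of_hamiltonian hz)

/-- Geodesics have constant speed, so their length is the speed times the elapsed time. -/
theorem curveLen_of_hamiltonian {z : ℝ → E × (E →L[ℝ] ℝ)} {J : Set ℝ} (hJ : IsOpen J)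
    (hJc : IsPreconnected J)
    (hz : ∀ t ∈ J, z t ∈ cotangent U ∧ HasDerivAt z (g.hamiltonianField (z t)) t) {a b s : ℝ}
    (hab : a ≤ b) (hsub : Icc a b ⊆ J) (hs : s ∈ J) :
    g.curveLen (fun t => (z t).1) a b
      = (b - a) * g.tangentNorm (z s).1 (g.sharp (z s).1 (z s).2) := by
  have h : ∀ t ∈ uIcc a b, g.tangentNorm (z t).1 (deriv (fun t => (z t).1) t)
      = g.tangentNorm (z s).1 (g.sharp (z s).1 (z s).2) := by
    intro t ht
    rw [uIcc_of_le hab] at ht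
    have h1 : deriv (fun t => (z t).1) t = g.sharp (z t).1 (z t).2 := 
      (hasDerivAt_fst_of_hamiltonian (hz t (hsub ht)).2).deriv
    rw [h1, tangentNorm, tangentNorm, form_velocity_eq hJ hJc hz (hsub ht) hs]
  rw [curveLen, intervalIntegral.integral_congr h]
  simp

/-- If the metric is proper, Hamiltonian solutions exist for all times: within the time `T`, a solution
of speed `s` stays within the distance `T * s` of its starting point, and its momentum is bounded as
its speed is constant. -/
theorem IsProper.exists_hamiltonian_flow (hg : g.IsProper) {z₀ : E × (E →L[ℝ] ℝ)}
    (hz₀ : z₀ ∈ cotangent U) :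
    ∃ z : ℝ → E × (E →L[ℝ] ℝ), z 0 = z₀ ∧
      ∀ t, z t ∈ cotangent U ∧ HasDerivAt z (g.hamiltonianField (z t)) t := by
  refine exists_hasDerivAt_of_forall_mem_compact isOpen_cotangent g.contDiffOn_hamiltonianField
    fun T hT => ?_
  set s := g.tangentNorm z₀.1 (g.sharp z₀.1 z₀.2) with hs
  have hs0 : 0 ≤ s := g.tangentNorm_nonneg _ _
  obtain ⟨K, hKU, hK, hball⟩ := hg z₀.1 hz₀.1 (T * s)
  obtain ⟨C, hC, hCK⟩ := g.exists_tangentNorm_le_norm hK hKU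
  have hP : ∀ z : E × (E →L[ℝ] ℝ), z.1 ∈ K → g.tangentNorm z.1 (g.sharp z.1 z.2) = s →
      ‖z.2‖ ≤ s * C := by
    intro z hz hzs
    refine ContinuousLinearMap.opNorm_le_bound _ (by positivity) fun w => ?_
    have h2 : ∀ w, z.2 w ≤ s * C * ‖w‖ := fun w => by
      calc z.2 w = g.toCLM z.1 (g.sharp z.1 z.2) w := by rw [g.toCLM_sharp (hKU hz)]
        _ ≤ s * g.tangentNorm z.1 w := by
          rw [← hzs]; exact g.form_le_tangentNorm_mul (hKU hz) _ _
        _ ≤ s * (C * ‖w‖) := by gcongr; exact hCK _ hz w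
        _ = s * C * ‖w‖ := by ring
    have h3 := h2 (-w)
    rw [map_neg, norm_neg] at h3
    exact abs_le.2 ⟨by linarith, h2 w⟩
  have hz₀K : z₀.1 ∈ K := hball _ (by rw [g.pathDist_self hz₀.1]; exact zero_le)
  refine ⟨K ×ˢ Metric.closedBall 0 (s * C), fun z hz => ⟨hKU hz.1, mem_univ _⟩,
    hK.prod (isCompact_closedBall _ _), ⟨hz₀K, ?_⟩, fun a ha z hz0 hz t ht => ?_⟩
  · rw [mem_closedBall_zero_iff]
    exact hP z₀ hz₀K rfl
  have h0 : (0 : ℝ) ∈ Ioo (-a) a := ⟨by linarith [ha.1], ha.1⟩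
  have hlen : ∀ u v : ℝ, u ≤ v → v - u ≤ T → Icc u v ⊆ Ioo (-a) a →
      g.pathDist (z u).1 (z v).1 ≤ ENNReal.ofReal (T * s) := by
    intro u v huv huvT hsub
    refine ((piecewiseSmoothOn_of_hamiltonian huv fun r hr => hz r (hsub hr)).pathDist_le g).trans
      (ENNReal.ofReal_le_ofReal ?_)
    rw [curveLen_of_hamiltonian isOpen_Ioo isPreconnected_Ioo hz huv hsub h0, hz0]
    gcongr
  have hmem : (z t).1 ∈ K := by
    refine hball _ ?_
    rcases le_total 0 t with h | h
    · have := hlen 0 t h (by linarith [ht.2, ha.2]) fun r hr =>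
        ⟨by linarith [hr.1, ha.1], by linarith [hr.2, ht.2]⟩
      rwa [hz0] at this
    · have := hlen t 0 h (by linarith [ht.1, ha.2]) fun r hr =>
        ⟨by linarith [hr.1, ht.1], by linarith [hr.2, ha.1]⟩
      rwa [hz0, pathDist_comm] at this
  refine ⟨hmem, ?_⟩
  rw [mem_closedBall_zero_iff]
  refine hP _ hmem ?_
  rw [hs, ← hz0, tangentNorm, tangentNorm, form_velocity_eq isOpen_Ioo isPreconnected_Ioo hz ht h0]

theorem IsProper.geodesicallyComplete (hg : g.IsProper) : g.GeodesicallyComplete := by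
  intro p hp v
  obtain ⟨z, hz0, hz⟩ := hg.exists_hamiltonian_flow (z₀ := (p, g.toCLM p v)) ⟨hp, mem_univ _⟩
  refine ⟨fun t => (z t).1, isGeodesicOn_of_hamiltonian hz uniqueDiffOn_univ, by simp [hz0], ?_⟩
  have h : deriv (fun t => (z t).1) 0 = g.sharp (z 0).1 (z 0).2 := 
    (hasDerivAt_fst_of_hamiltonian (hz 0).2).deriv
  rw [h, hz0, g.sharp_toCLM hp]

end Hamiltonian

/-! ### Minimisers of the discrete energy -/

section DiscreteEnergy

variable {E : Type*} [NormedAddCommGroup E] [NormedSpace ℝ E] [FiniteDimensional ℝ E]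
  {U : TopologicalSpace.Opens E} (g : RiemannianMetricOn U)

/-- Two points at distance less than `r` are joined by a chain of `N` steps of length less than
`r / N`: subdivide a curve between them into pieces of equal length. The points of the chain beyond
the index `N` play no role, but they too stay close to `p`. -/
theorem exists_chain {p q : E} {r : ℝ} (h : g.pathDist p q < ENNReal.ofReal r) {N : ℕ}
    (hN : 0 < N) : ∃ y : ℕ → E, y 0 = p ∧ y N = q ∧
      (∀ i, g.pathDist p (y i) ≤ ENNReal.ofReal r) ∧
      ∀ i < N, g.pathDist (y i) (y (i + 1)) < ENNReal.ofReal (r / N) := by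
  obtain ⟨γ, hγ, rfl, rfl, hlen⟩ := g.exists_curveLen_lt h
  have hN' : (0 : ℝ) < N := Nat.cast_pos.2 hN
  set ℓ := g.curveLen γ 0 1 with hℓ
  have hℓ0 : 0 ≤ ℓ := g.curveLen_nonneg γ zero_le_one
  have hdist : ∀ a ∈ Icc (0 : ℝ) 1, ∀ b ∈ Icc (0 : ℝ) 1,
      g.pathDist (γ a) (γ b) ≤ ENNReal.ofReal |g.curveLen γ 0 b - g.curveLen γ 0 a| := by
    intro a ha b hb
    wlog hab : a ≤ b generalizing a b
    · rw [pathDist_comm, abs_sub_comm]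
      exact this b hb a ha (le_of_not_ge hab)
    have h1 := (hγ.restrict le_rfl ha.1 ha.2).curveLen_add g (hγ.restrict ha.1 hab hb.2)
    rw [← h1, add_sub_cancel_left]
    exact ((hγ.restrict ha.1 hab hb.2).pathDist_le g).trans
      (ENNReal.ofReal_le_ofReal (le_abs_self _))
  have hcont : ContinuousOn (fun t => g.curveLen γ 0 t) (Icc 0 1) := by
    have := intervalIntegral.continuousOn_primitive_interval' (hγ.intervalIntegrable g)
      (left_mem_uIcc (a := (0 : ℝ)) (b := 1))
    rwa [uIcc_of_le zero_le_one] at this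
  have h00 : g.curveLen γ 0 0 = 0 := intervalIntegral.integral_same
  have hex : ∀ i : ℕ, ∃ t ∈ Icc (0 : ℝ) 1, (i = 0 → t = 0) ∧ (i = N → t = 1) ∧
      (i ≤ N → g.curveLen γ 0 t = i * (ℓ / N)) := by
    intro i
    rcases Nat.eq_zero_or_pos i with rfl | hi
    · exact ⟨0, ⟨le_rfl, zero_le_one⟩, fun _ => rfl, fun h => absurd h hN.ne,
        fun _ => by rw [h00]; simp⟩
    rcases lt_or_ge i N with hiN | hiN
    · obtain ⟨t, ht, hte⟩ := intermediate_value_Icc zero_le_one hcont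
        (show (i : ℝ) * (ℓ / N) ∈ Icc _ _ by
          rw [h00]
          refine ⟨by positivity, ?_⟩
          have : (i : ℝ) ≤ N := by exact_mod_cast hiN.le
          calc (i : ℝ) * (ℓ / N) ≤ N * (ℓ / N) := by gcongr
            _ = g.curveLen γ 0 1 := by rw [← hℓ]; field_simp)
      exact ⟨t, ht, fun h => absurd h hi.ne', fun h => absurd h hiN.ne, fun _ => hte⟩
    · refine ⟨1, ⟨zero_le_one, le_rfl⟩, fun h => absurd h hi.ne', fun _ => rfl, fun h => ?_⟩
      obtain rfl : i = N := le_antisymm h hiN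
      rw [← hℓ]
      field_simp
  choose t ht ht0 htN hts using hex
  refine ⟨fun i => γ (t i), congrArg γ (ht0 0 rfl), congrArg γ (htN N rfl), fun i => ?_, fun i hi => ?_⟩
  · refine (hdist 0 ⟨le_rfl, zero_le_one⟩ _ (ht i)).trans (ENNReal.ofReal_le_ofReal ?_)
    rw [h00, sub_zero, abs_of_nonneg (g.curveLen_nonneg γ (ht i).1)]
    have h1 := (hγ.restrict le_rfl (ht i).1 (ht i).2).curveLen_add g
      (hγ.restrict (ht i).1 (ht i).2 le_rfl)
    have h2 := g.curveLen_nonneg γ (ht i).2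
    linarith
  · refine (hdist _ (ht i) _ (ht (i + 1))).trans_lt ?_
    rw [hts i hi.le, hts (i + 1) hi]
    have : ((i + 1 : ℕ) : ℝ) * (ℓ / N) - i * (ℓ / N) = ℓ / N := by push_cast; ring
    rw [this, abs_of_nonneg (by positivity), ENNReal.ofReal_lt_ofReal_iff (by
      have := hℓ0.trans_lt hlen
      positivity)]
    gcongr

/-- The energy of the polygon with vertices `x 0, …, x N`, each edge being measured at its first
vertex. -/
def discreteEnergy (N : ℕ) (x : ℕ → E) : ℝ :=
  N * ∑ i ∈ Finset.range N, g.form (x i) (x (i + 1) - x i) (x (i + 1) - x i)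

variable {g}

/-- The discrete energy of suitable fine polygons is at most the squared geodesic distance. -/
theorem IsProper.eventually_exists_discreteEnergy_le (hg : g.IsProper) {p q : E} (hp : p ∈ U)
    {B : ℝ} (h : g.pathDist p q < ENNReal.ofReal B) :
    ∀ᶠ N : ℕ in atTop, ∃ y : ℕ → E, y 0 = p ∧ y N = q ∧
      (∀ i, g.pathDist p (y i) ≤ ENNReal.ofReal B) ∧ g.discreteEnergy N y ≤ B ^ 2 := by
  obtain ⟨r, hr0, hpr, hrB⟩ : ∃ r, 0 < r ∧ g.pathDist p q < ENNReal.ofReal r ∧ r < B := by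
    obtain ⟨γ, hγ, rfl, rfl, hlen⟩ := g.exists_curveLen_lt h
    have h0 := g.curveLen_nonneg γ zero_le_one
    refine ⟨(g.curveLen γ 0 1 + B) / 2, by linarith, (hγ.pathDist_le g).trans_lt ?_, by linarith⟩
    rw [ENNReal.ofReal_lt_ofReal_iff (by linarith)]
    linarith
  obtain ⟨K, hKU, hK, hball⟩ := hg p hp r
  obtain ⟨δ, hδ, hL⟩ := g.exists_tangentNorm_sub_le hK hKU (η := B / r - 1)
    (sub_pos.2 ((one_lt_div hr0).2 hrB))
  have hlim : Tendsto (fun N : ℕ => r / N) atTop (𝓝 0) := tendsto_const_div_atTop_nhds_zero_nat r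
  filter_upwards [eventually_gt_atTop 0, hlim.eventually_le_const hδ] with N hN hNδ
  obtain ⟨y, hy0, hyN, hyr, hstep⟩ := g.exists_chain hpr hN
  have hN' : (0 : ℝ) < N := Nat.cast_pos.2 hN
  refine ⟨y, hy0, hyN, fun i => (hyr i).trans (ENNReal.ofReal_le_ofReal hrB.le), ?_⟩
  have hterm : ∀ i ∈ Finset.range N, g.form (y i) (y (i + 1) - y i) (y (i + 1) - y i)
      ≤ (B / N) ^ 2 := by
    intro i hi
    have hyi := hball _ (hyr i)
    have h1 := hL _ hyi _ _ hNδ (hstep i (Finset.mem_range.1 hi))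
    rw [← g.sq_tangentNorm (hKU hyi)]
    refine pow_le_pow_left₀ (g.tangentNorm_nonneg _ _) (h1.trans_eq ?_) 2
    field_simp
    ring
  calc g.discreteEnergy N y ≤ N * ∑ _ ∈ Finset.range N, (B / N) ^ 2 := by
        unfold discreteEnergy
        gcongr with i hi
        exact hterm i hi
    _ = B ^ 2 := by
        rw [Finset.sum_const, Finset.card_range, nsmul_eq_mul]
        field_simp

omit [FiniteDimensional ℝ E] in
theorem sum_tangentNorm_le {N : ℕ} {x : ℕ → E} (hx : ∀ i, x i ∈ U) {B : ℝ} (hB : 0 ≤ B)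
    (hE : g.discreteEnergy N x ≤ B ^ 2) :
    ∑ i ∈ Finset.range N, g.tangentNorm (x i) (x (i + 1) - x i) ≤ B := by
  refine le_of_sq_le_sq ((sq_sum_le_card_mul_sum_sq).trans ?_) hB
  simp only [Finset.card_range, g.sq_tangentNorm (hx _)]
  exact hE

omit [FiniteDimensional ℝ E] in
theorem tangentNorm_le_of_discreteEnergy_le {N : ℕ} (hN : 0 < N) {x : ℕ → E} (hx : ∀ i, x i ∈ U)
    {B : ℝ} (hB : 0 ≤ B) (hE : g.discreteEnergy N x ≤ B ^ 2) {i : ℕ} (hi : i < N) :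
    g.tangentNorm (x i) (x (i + 1) - x i) ≤ B / √N := by
  have hN' : (0 : ℝ) < N := Nat.cast_pos.2 hN
  refine le_of_sq_le_sq ?_ (by positivity)
  rw [div_pow, Real.sq_sqrt hN'.le, le_div_iff₀ hN', g.sq_tangentNorm (hx i), mul_comm]
  refine le_trans ?_ hE
  unfold discreteEnergy
  gcongr
  exact Finset.single_le_sum
    (f := fun i => g.form (x i) (x (i + 1) - x i) (x (i + 1) - x i))
    (fun j _ => g.form_self_nonneg (hx j) _) (Finset.mem_range.2 hi)

/-- Minimisers of the discrete energy among polygons in a compact neighbourhood of a large ball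
stay inside the ball, if the polygons are fine enough. -/
theorem IsProper.exists_minimizers (hg : g.IsProper) {p q : E} (hp : p ∈ U)
    (hpq : g.pathDist p q ≠ ⊤) :
    ∃ K K' : Set E, IsCompact K ∧ K ⊆ interior K' ∧ K' ⊆ U ∧ p ∈ K ∧ ∃ x : ℕ → ℕ → E,
      (∀ᶠ N in atTop, x N 0 = p ∧ x N N = q ∧ (∀ i ≤ N, x N i ∈ K) ∧ (∀ i, x N i ∈ K') ∧
        ∀ y : ℕ → E, y 0 = p → y N = q → (∀ i, y i ∈ K') →
          g.discreteEnergy N (x N) ≤ g.discreteEnergy N y) ∧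
      ∀ B : ℝ, g.pathDist p q < ENNReal.ofReal B →
        ∀ᶠ N in atTop, g.discreteEnergy N (x N) ≤ B ^ 2 := by
  set D := (g.pathDist p q).toReal with hD
  have hD0 : 0 ≤ D := ENNReal.toReal_nonneg
  have hpD : g.pathDist p q < ENNReal.ofReal (D + 1) := by
    rw [← ENNReal.ofReal_toReal hpq, ENNReal.ofReal_lt_ofReal_iff (by linarith)]
    linarith
  obtain ⟨K, hKU, hK, hball⟩ := hg p hp (2 * (D + 1))
  obtain ⟨K', hK', hKK', hK'U⟩ := exists_compact_between hK U.isOpen hKU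
  have hpK : p ∈ K := hball _ (by rw [g.pathDist_self hp]; exact zero_le)
  have hqK : q ∈ K := hball _ (hpD.le.trans (ENNReal.ofReal_le_ofReal (by linarith)))
  have hKK'' : K ⊆ K' := hKK'.trans interior_subset
  -- existence of minimisers
  have hmin : ∀ N : ℕ, ∃ x : ℕ → E, (∀ i, x i ∈ K') ∧ (0 < N → x 0 = p ∧ x N = q ∧
      ∀ y : ℕ → E, y 0 = p → y N = q → (∀ i, y i ∈ K') →
        g.discreteEnergy N x ≤ g.discreteEnergy N y) := by
    intro N
    rcases Nat.eq_zero_or_pos N with rfl | hN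
    · exact ⟨fun _ => p, fun _ => hKK'' hpK, fun h => absurd h (lt_irrefl _)⟩
    -- polygons are infinite sequences, so that the constraints define a product of compact sets
    let S : ℕ → Set E := fun i => if i = 0 then {p} else if i = N then {q} else K'
    have hS : IsCompact (univ.pi S) := isCompact_univ_pi fun i => by
      simp only [S]
      split_ifs
      exacts [isCompact_singleton, isCompact_singleton, hK']
    have hmemS : ∀ y : ℕ → E, y ∈ univ.pi S ↔ y 0 = p ∧ y N = q ∧ ∀ i, y i ∈ K' := by
      intro y
      simp only [mem_univ_pi, S]
      constructor
      · intro h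
        have h0 : y 0 = p := by simpa using h 0
        have h1 : y N = q := by simpa [hN.ne'] using h N
        refine ⟨h0, h1, fun i => ?_⟩
        by_cases hi0 : i = 0
        · rw [hi0, h0]; exact hKK'' hpK
        by_cases hiN : i = N
        · rw [hiN, h1]; exact hKK'' hqK
        · simpa [hi0, hiN] using h i
      · rintro ⟨h0, h1, h⟩ i
        split_ifs with hi0 hiN
        · rw [hi0]; exact h0
        · rw [hiN]; exact h1
        · exact h i
    have hne : (univ.pi S).Nonempty := ⟨fun i => if i = 0 then p else q, (hmemS _).2
      ⟨by simp, by simp [hN.ne'], fun i => by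
        split_ifs; exacts [hKK'' hpK, hKK'' hqK]⟩⟩
    have hcont : ContinuousOn (g.discreteEnergy N) (univ.pi S) := by
      refine continuousOn_const.mul (continuousOn_finsetSum _ fun i _ => ?_)
      have h1 : ContinuousOn (fun x : ℕ → E => g.toCLM (x i)) (univ.pi S) :=
        g.continuousOn_toCLM.comp (continuous_apply i).continuousOn fun x hx =>
          hK'U (((hmemS x).1 hx).2.2 i)
      have h2 : ContinuousOn (fun x : ℕ → E => x (i + 1) - x i) (univ.pi S) :=
        Continuous.continuousOn (by fun_prop)
      exact (h1.clm_apply h2).clm_apply h2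
    obtain ⟨x, hx, hmin⟩ := hS.exists_isMinOn hne hcont
    obtain ⟨h0, h1, h2⟩ := (hmemS x).1 hx
    exact ⟨x, h2, fun _ => ⟨h0, h1, fun y hy0 hy1 hy => hmin ((hmemS y).2 ⟨hy0, hy1, hy⟩)⟩⟩
  choose x hxK' hx using hmin
  have henergy : ∀ B : ℝ, g.pathDist p q < ENNReal.ofReal B →
      ∀ᶠ N in atTop, g.discreteEnergy N (x N) ≤ B ^ 2 := by
    intro B hB
    have hB' : g.pathDist p q < ENNReal.ofReal (min B (D + 1)) := by
      rw [ENNReal.ofReal_min]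
      exact lt_min hB hpD
    have hpos : 0 < min B (D + 1) := ENNReal.ofReal_pos.1 (zero_le.trans_lt hB')
    filter_upwards [eventually_gt_atTop 0, hg.eventually_exists_discreteEnergy_le hp hB'] with
      N hN ⟨y, hy0, hyN, hyB, hyE⟩
    have h1 := (hx N hN).2.2 y hy0 hyN fun i => hKK'' (hball _ ((hyB i).trans
      (ENNReal.ofReal_le_ofReal ((min_le_right _ _).trans (by linarith)))))
    exact (h1.trans hyE).trans (pow_le_pow_left₀ hpos.le (min_le_left _ _) 2)
  refine ⟨K, K', hK, hKK', hK'U, hpK, x, ?_, henergy⟩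
  obtain ⟨c, hc, hcn⟩ := g.exists_norm_le_tangentNorm hK' hK'U
  obtain ⟨δ, hδ, hU⟩ := g.exists_pathDist_le hK' hK'U one_pos
  have hlim : Tendsto (fun N : ℕ => c * ((D + 1) / √N)) atTop (𝓝 0) := by
    have h1 : Tendsto (fun N : ℕ => √(N : ℝ)) atTop atTop :=
      Real.tendsto_sqrt_atTop.comp tendsto_natCast_atTop_atTop
    simpa using (h1.const_div_atTop (D + 1)).const_mul c
  filter_upwards [eventually_gt_atTop 0, henergy _ hpD, hlim.eventually_le_const hδ] with
    N hN hE hNδ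
  obtain ⟨h0, h1, h2⟩ := hx N hN
  have hxU : ∀ i, x N i ∈ U := fun i => hK'U (hxK' N i)
  refine ⟨h0, h1, fun i hi => hball _ ?_, hxK' N, h2⟩
  have hstep : ∀ j < N, g.pathDist (x N j) (x N (j + 1))
      ≤ ENNReal.ofReal (2 * g.tangentNorm (x N j) (x N (j + 1) - x N j)) := by
    intro j hj
    have h3 := hU _ (hxK' N j) (x N (j + 1)) (by
      refine (hcn _ (hxK' N j) _).trans (le_trans ?_ hNδ)
      gcongr
      exact tangentNorm_le_of_discreteEnergy_le hN hxU (by linarith) hE hj)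
    rw [one_add_one_eq_two] at h3
    exact h3.2
  -- the distance from `p` is at most twice the length of the polygon, hence at most `2 * (D + 1)`
  have hsum : ∀ j ≤ N, g.pathDist p (x N j) ≤ ENNReal.ofReal
      (2 * ∑ k ∈ Finset.range j, g.tangentNorm (x N k) (x N (k + 1) - x N k)) := by
    intro j hj
    induction j with
    | zero => rw [h0, g.pathDist_self hp]; exact zero_le
    | succ j ih =>
      refine (g.pathDist_triangle _ (x N j) _).trans
        ((add_le_add (ih (by omega)) (hstep j (by omega))).trans_eq ?_)
      rw [Finset.sum_range_succ, mul_add, ENNReal.ofReal_add]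
      · exact mul_nonneg zero_le_two (Finset.sum_nonneg fun _ _ => g.tangentNorm_nonneg _ _)
      · exact mul_nonneg zero_le_two (g.tangentNorm_nonneg _ _)
  refine (hsum i hi).trans (ENNReal.ofReal_le_ofReal ?_)
  have h3 := sum_tangentNorm_le hxU (by linarith) hE
  have h4 : ∑ k ∈ Finset.range i, g.tangentNorm (x N k) (x N (k + 1) - x N k)
      ≤ ∑ k ∈ Finset.range N, g.tangentNorm (x N k) (x N (k + 1) - x N k) :=
    Finset.sum_le_sum_of_subset_of_nonneg (Finset.range_subset_range.2 hi)
      fun _ _ _ => g.tangentNorm_nonneg _ _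
  linarith

end DiscreteEnergy

/-! ### The Euler-Lagrange equations of the discrete energy -/

section EulerLagrange

set_option maxSynthPendingDepth 4

variable {E : Type*} [NormedAddCommGroup E] [NormedSpace ℝ E] [FiniteDimensional ℝ E]
  {U : TopologicalSpace.Opens E} {g : RiemannianMetricOn U}

theorem hasDerivAt_form_add_smul {x : E} (hx : x ∈ U) (W Δ V : E) :
    HasDerivAt (fun s : ℝ => g.form (x + s • W) (Δ + s • V) (Δ + s • V))
      (g.gradForm x Δ W + 2 * g.form x Δ V) 0 := by
  have hline : ∀ a b : E, HasDerivAt (fun s : ℝ => a + s • b) b 0 := fun a b => by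
    simpa using ((hasDerivAt_id (0 : ℝ)).smul_const b).const_add a
  have hG : HasDerivAt (fun s : ℝ => g.toCLM (x + s • W)) (fderiv ℝ g.toCLM x W) 0 :=
    HasFDerivAt.comp_hasDerivAt_of_eq (l := g.toCLM) 0 (g.hasFDerivAt_toCLM hx) (hline x W)
      (by simp)
  refine ((hG.clm_apply (hline Δ V)).clm_apply (hline Δ V)).congr_deriv ?_
  simp only [zero_smul, add_zero]
  change fderiv ℝ g.toCLM x W Δ Δ + g.form x V Δ + g.form x Δ V = _
  rw [g.symm x hx V Δ, gradForm_apply]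
  ring

/-- The Euler-Lagrange equation of the discrete energy: it is a discretisation of the Hamiltonian
equation for the momentum. -/
theorem discrete_euler_lagrange {K' : Set E} (hK' : K' ⊆ U) {N : ℕ} (hN : 0 < N) {x : ℕ → E}
    (hx : ∀ i, x i ∈ K')
    (hmin : ∀ y : ℕ → E, y 0 = x 0 → y N = x N → (∀ i, y i ∈ K') →
      g.discreteEnergy N x ≤ g.discreteEnergy N y) {i : ℕ} (hi : i + 1 < N)
    (hint : x (i + 1) ∈ interior K') :
    g.toCLM (x (i + 1)) (x (i + 1 + 1) - x (i + 1)) - g.toCLM (x i) (x (i + 1) - x i)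
      = (1 / 2 : ℝ) • g.gradForm (x (i + 1)) (x (i + 1 + 1) - x (i + 1)) := by
  have hN' : (0 : ℝ) < N := Nat.cast_pos.2 hN
  ext w
  -- variation of the vertex `x (i + 1)` in the direction `w`
  let W : ℕ → E := fun j => if j = i + 1 then w else 0
  let φ : ℝ → ℝ := fun s => ∑ j ∈ Finset.range N, g.form (x j + s • W j)
    ((x (j + 1) - x j) + s • (W (j + 1) - W j)) ((x (j + 1) - x j) + s • (W (j + 1) - W j))
  have hφE : ∀ s, g.discreteEnergy N (fun j => x j + s • W j) = N * φ s := by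
    intro s
    simp only [discreteEnergy, φ]
    congr 1
    refine Finset.sum_congr rfl fun j _ => ?_
    have : x (j + 1) + s • W (j + 1) - (x j + s • W j)
        = x (j + 1) - x j + s • (W (j + 1) - W j) := by rw [smul_sub]; abel
    rw [this]
  have hφ' : HasDerivAt φ (∑ j ∈ Finset.range N, (g.gradForm (x j) (x (j + 1) - x j) (W j)
      + 2 * g.form (x j) (x (j + 1) - x j) (W (j + 1) - W j))) 0 :=
    HasDerivAt.fun_sum fun j _ => hasDerivAt_form_add_smul (hK' (hx j)) _ _ _
  have hloc : IsLocalMin φ 0 := by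
    have hcont : Tendsto (fun s : ℝ => x (i + 1) + s • w) (𝓝 0) (𝓝 (x (i + 1))) := by
      have : Continuous fun s : ℝ => x (i + 1) + s • w := by fun_prop
      simpa using this.tendsto 0
    filter_upwards [hcont.eventually_mem (mem_interior_iff_mem_nhds.1 hint)] with s hs
    have h1 := hmin (fun j => x j + s • W j) (by simp [W]) (by simp [W, hi.ne']) fun j => by
      by_cases hj : j = i + 1
      · simpa [W, hj] using hs
      · simpa [W, hj] using hx j
    have h2 := hφE 0
    simp only [zero_smul, add_zero] at h2
    rw [hφE, h2] at h1
    exact le_of_mul_le_mul_left h1 hN'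
  have h0 := hloc.hasDerivAt_eq_zero hφ'
  have hsplit : ∀ j, g.gradForm (x j) (x (j + 1) - x j) (W j)
      + 2 * g.form (x j) (x (j + 1) - x j) (W (j + 1) - W j)
      = (if j = i + 1 then g.gradForm (x j) (x (j + 1) - x j) w
          - 2 * g.form (x j) (x (j + 1) - x j) w else 0)
        + if j = i then 2 * g.form (x j) (x (j + 1) - x j) w else 0 := by
    intro j
    rw [map_sub]
    by_cases h1 : j = i + 1
    · have h2 : ¬ j = i := by omega
      simp [W, h1]
      ring
    · by_cases h2 : j = i
      · simp [W, h2]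
      · simp [W, h1, h2]
  rw [Finset.sum_congr rfl fun j _ => hsplit j, Finset.sum_add_distrib, Finset.sum_ite_eq',
    Finset.sum_ite_eq', if_pos (Finset.mem_range.2 hi),
    if_pos (Finset.mem_range.2 (by omega : i < N))] at h0
  change g.form (x (i + 1)) (x (i + 1 + 1) - x (i + 1)) w - g.form (x i) (x (i + 1) - x i) w
    = 1 / 2 * g.gradForm (x (i + 1)) (x (i + 1 + 1) - x (i + 1)) w
  linarith

theorem gradForm_smul (x : E) (a : ℝ) (v : E) :
    g.gradForm x (a • v) = a ^ 2 • g.gradForm x v := by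
  ext w
  simp only [gradForm_apply, map_smul, smul_apply, smul_eq_mul]
  ring

/-- The phase space point of a polygon with `N` edges at its `i`-th vertex. The momentum is the
covector of the velocity `N • (x (i + 1) - x i)`, as each edge takes the time `1 / N`. -/
def discretePhase (g : RiemannianMetricOn U) (N : ℕ) (x : ℕ → E) (i : ℕ) : E × (E →L[ℝ] ℝ) :=
  (x i, g.toCLM (x i) ((N : ℝ) • (x (i + 1) - x i)))

theorem sharp_discretePhase {N : ℕ} {x : ℕ → E} {i : ℕ} (hx : x i ∈ U) :
    g.sharp (g.discretePhase N x i).1 (g.discretePhase N x i).2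
      = (N : ℝ) • (x (i + 1) - x i) :=
  g.sharp_toCLM hx _

theorem discretePhase_fst_succ {N : ℕ} (hN : 0 < N) {x : ℕ → E} {i : ℕ} (hx : x i ∈ U) :
    x (i + 1) - x i = (1 / N : ℝ) • (g.hamiltonianField (g.discretePhase N x i)).1 := by
  have hN' : (N : ℝ) ≠ 0 := Nat.cast_ne_zero.2 hN.ne'
  rw [hamiltonianField, sharp_discretePhase hx, smul_smul, one_div_mul_cancel hN', one_smul]

theorem discretePhase_snd_succ {K' : Set E} (hK' : K' ⊆ U) {N : ℕ} (hN : 0 < N) {x : ℕ → E}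
    (hx : ∀ i, x i ∈ K')
    (hmin : ∀ y : ℕ → E, y 0 = x 0 → y N = x N → (∀ i, y i ∈ K') →
      g.discreteEnergy N x ≤ g.discreteEnergy N y) {i : ℕ} (hi : i + 1 < N)
    (hint : x (i + 1) ∈ interior K') :
    (g.discretePhase N x (i + 1)).2 - (g.discretePhase N x i).2
      = (1 / N : ℝ) • (g.hamiltonianField (g.discretePhase N x (i + 1))).2 := by
  have hN' : (N : ℝ) ≠ 0 := Nat.cast_ne_zero.2 hN.ne'
  have h1 := discrete_euler_lagrange hK' hN hx hmin hi hint
  rw [hamiltonianField, sharp_discretePhase (hK' (hx _))]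
  simp only [discretePhase]
  rw [gradForm_smul, map_smul, map_smul, ← smul_sub, h1, smul_smul, smul_smul, smul_smul]
  congr 1
  field_simp

omit [FiniteDimensional ℝ E] in
theorem discreteEnergy_eq {N : ℕ} (hN : 0 < N) {x : ℕ → E} :
    g.discreteEnergy N x = 1 / N * ∑ i ∈ Finset.range N,
      g.form (x i) ((N : ℝ) • (x (i + 1) - x i)) ((N : ℝ) • (x (i + 1) - x i)) := by
  have hN' : (N : ℝ) ≠ 0 := Nat.cast_ne_zero.2 hN.ne'
  simp only [discreteEnergy, map_smul, LinearMap.smul_apply, smul_eq_mul, ← Finset.mul_sum]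
  field_simp

omit [FiniteDimensional ℝ E] in
theorem exists_form_le_discreteEnergy {N : ℕ} (hN : 0 < N) (x : ℕ → E) :
    ∃ i < N, g.form (x i) ((N : ℝ) • (x (i + 1) - x i)) ((N : ℝ) • (x (i + 1) - x i))
      ≤ g.discreteEnergy N x := by
  have hN' : (0 : ℝ) < N := Nat.cast_pos.2 hN
  have hsum : ∑ i ∈ Finset.range N, g.form (x i) ((N : ℝ) • (x (i + 1) - x i))
      ((N : ℝ) • (x (i + 1) - x i)) ≤ ∑ _ ∈ Finset.range N, g.discreteEnergy N x := by
    rw [Finset.sum_const, Finset.card_range, nsmul_eq_mul, discreteEnergy_eq hN]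
    apply le_of_eq
    field_simp
  obtain ⟨i, hi, h⟩ := Finset.exists_le_of_sum_le (Finset.nonempty_range_iff.2 hN.ne') hsum
  exact ⟨i, Finset.mem_range.1 hi, h⟩

/-- The momenta of minimisers of the discrete energy are bounded in terms of the energy. -/
theorem exists_bound_discretePhase_snd {K K' : Set E} (hK : IsCompact K) (hKU : K ⊆ U)
    (hKK' : K ⊆ interior K') (hK' : K' ⊆ U) (B : ℝ) :
    ∃ M, ∀ N : ℕ, 0 < N → ∀ x : ℕ → E, (∀ i ≤ N, x i ∈ K) → (∀ i, x i ∈ K') →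
      (∀ y : ℕ → E, y 0 = x 0 → y N = x N → (∀ i, y i ∈ K') →
        g.discreteEnergy N x ≤ g.discreteEnergy N y) → g.discreteEnergy N x ≤ B ^ 2 →
      ∀ i < N, ‖(g.discretePhase N x i).2‖ ≤ M := by
  obtain ⟨c, hc, hcn⟩ := g.exists_norm_le_tangentNorm hK hKU
  obtain ⟨C₀, hC₀⟩ := hK.exists_bound_of_continuousOn (f := g.toCLM) (g.continuousOn_toCLM.mono hKU)
  have hD : ContinuousOn (fderiv ℝ g.toCLM) U :=
    g.contDiffOn_toCLM.continuousOn_fderiv_of_isOpen U.isOpen (by simp)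
  obtain ⟨C₁, hC₁⟩ := hK.exists_bound_of_continuousOn (f := fderiv ℝ g.toCLM) (hD.mono hKU)
  refine ⟨max C₀ 0 * (c * |B|) + max C₁ 0 * c ^ 2 * B ^ 2, ?_⟩
  intro N hN x hx hxK' hmin hE i hi
  have hN' : (0 : ℝ) < N := Nat.cast_pos.2 hN
  set v : ℕ → E := fun i => (N : ℝ) • (x (i + 1) - x i) with hv
  have hvn : ∀ j < N, ‖v j‖ ^ 2 ≤ c ^ 2 * g.form (x j) (v j) (v j) := fun j hj => by
    rw [← g.sq_tangentNorm (hKU (hx j hj.le)), ← mul_pow]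
    exact pow_le_pow_left₀ (norm_nonneg _) (hcn _ (hx j hj.le) _) 2
  have hgrad : ∀ j < N, ‖g.gradForm (x j) (v j)‖ ≤ max C₁ 0 * ‖v j‖ ^ 2 := by
    intro j hj
    refine ContinuousLinearMap.opNorm_le_bound _ (by positivity) fun w => ?_
    calc ‖g.gradForm (x j) (v j) w‖ = ‖fderiv ℝ g.toCLM (x j) w (v j) (v j)‖ := rfl
      _ ≤ ‖fderiv ℝ g.toCLM (x j) w‖ * ‖v j‖ * ‖v j‖ := ContinuousLinearMap.le_opNorm₂ _ _ _
      _ ≤ ‖fderiv ℝ g.toCLM (x j)‖ * ‖w‖ * ‖v j‖ * ‖v j‖ := by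
        gcongr
        exact ContinuousLinearMap.le_opNorm _ _
      _ ≤ max C₁ 0 * ‖w‖ * ‖v j‖ * ‖v j‖ := by
        gcongr
        exact (hC₁ _ (hx j hj.le)).trans (le_max_left _ _)
      _ = max C₁ 0 * ‖v j‖ ^ 2 * ‖w‖ := by ring
  have hnn : ∀ j, 0 ≤ g.form (x j) (v j) (v j) := fun j => g.form_self_nonneg (hK' (hxK' j)) _
  have hstep : ∀ j, j + 1 < N → ‖(g.discretePhase N x (j + 1)).2 - (g.discretePhase N x j).2‖
      ≤ max C₁ 0 * c ^ 2 * (1 / N * g.form (x (j + 1)) (v (j + 1)) (v (j + 1))) := by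
    intro j hj
    rw [discretePhase_snd_succ hK' hN hxK' hmin hj (hKK' (hx _ hj.le)), hamiltonianField,
      sharp_discretePhase (hK' (hxK' _)), smul_smul, norm_smul,
      Real.norm_of_nonneg (by positivity)]
    calc 1 / (N : ℝ) * (1 / 2) * ‖g.gradForm (x (j + 1)) (v (j + 1))‖
        ≤ 1 / (N : ℝ) * 1 * (max C₁ 0 * (c ^ 2 * g.form (x (j + 1)) (v (j + 1)) (v (j + 1)))) := by
          gcongr
          · norm_num
          · exact (hgrad _ hj).trans (by gcongr; exact hvn _ hj)
      _ = _ := by ring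
  have htotal : ∑ j ∈ Finset.range N, max C₁ 0 * c ^ 2 * (1 / N * g.form (x j) (v j) (v j))
      ≤ max C₁ 0 * c ^ 2 * B ^ 2 := by
    rw [← Finset.mul_sum, ← Finset.mul_sum, ← discreteEnergy_eq hN]
    gcongr
  have hpath : ∀ a b, a ≤ b → b < N →
      ‖(g.discretePhase N x b).2 - (g.discretePhase N x a).2‖ ≤ max C₁ 0 * c ^ 2 * B ^ 2 := by
    intro a b hab hb
    have h1 : ∀ k, a + k < N → ‖(g.discretePhase N x (a + k)).2 - (g.discretePhase N x a).2‖
        ≤ ∑ j ∈ Finset.range (a + k + 1),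
          max C₁ 0 * c ^ 2 * (1 / N * g.form (x j) (v j) (v j)) := by
      intro k hk
      induction k with
      | zero =>
        rw [add_zero, sub_self, norm_zero]
        exact Finset.sum_nonneg fun j _ => mul_nonneg (by positivity)
          (mul_nonneg (by positivity) (hnn j))
      | succ k ih =>
        have h2 := ih (by omega)
        have h3 := hstep (a + k) hk
        rw [← add_assoc, Finset.sum_range_succ]
        have h4 := norm_sub_le_norm_sub_add_norm_sub (g.discretePhase N x (a + k + 1)).2
          (g.discretePhase N x (a + k)).2 (g.discretePhase N x a).2
        linarith
    obtain ⟨k, rfl⟩ := Nat.exists_eq_add_of_le hab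
    refine (h1 k hb).trans (le_trans ?_ htotal)
    exact Finset.sum_le_sum_of_subset_of_nonneg (Finset.range_subset_range.2 hb)
      fun j _ _ => mul_nonneg (by positivity) (mul_nonneg (by positivity) (hnn j))
  -- some momentum is bounded since the energy is an average
  obtain ⟨j, hj, hjE⟩ := exists_form_le_discreteEnergy (g := g) hN x
  have hPj : ‖(g.discretePhase N x j).2‖ ≤ max C₀ 0 * (c * |B|) := by
    have h1 : ‖v j‖ ≤ c * |B| := by
      refine le_of_sq_le_sq ((hvn j hj).trans ?_) (by positivity)
      rw [mul_pow, sq_abs]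
      gcongr
      exact hjE.trans hE
    calc ‖g.toCLM (x j) (v j)‖ ≤ ‖g.toCLM (x j)‖ * ‖v j‖ := ContinuousLinearMap.le_opNorm _ _
      _ ≤ max C₀ 0 * (c * |B|) := by
        gcongr
        exact (hC₀ _ (hx j hj.le)).trans (le_max_left _ _)
  have hij : ‖(g.discretePhase N x i).2 - (g.discretePhase N x j).2‖
      ≤ max C₁ 0 * c ^ 2 * B ^ 2 := by
    rcases le_total i j with h | h
    · rw [norm_sub_rev]; exact hpath i j h hj
    · exact hpath j i h hi
  have := norm_le_norm_add_norm_sub' (g.discretePhase N x i).2 (g.discretePhase N x j).2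
  linarith

end EulerLagrange

end RiemannianMetricOn

/-! ### Convergence of the Euler scheme -/

section Euler

variable {F : Type*} [NormedAddCommGroup F] [NormedSpace ℝ F]

theorem norm_sub_le_of_hasDerivAt_of_norm_le {Y : F → F} {B : NNReal} (hB : ∀ z, ‖Y z‖ ≤ B)
    {z : ℝ → F} (hz : ∀ t ∈ Icc (0 : ℝ) 1, HasDerivAt z (Y (z t)) t) {s t : ℝ}
    (hs : s ∈ Icc (0 : ℝ) 1) (ht : t ∈ Icc (0 : ℝ) 1) : ‖z t - z s‖ ≤ B * |t - s| :=
  (convex_Icc 0 1).norm_image_sub_le_of_norm_hasDerivWithin_le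
    (fun r hr => (hz r hr).hasDerivWithinAt) (fun _ _ => hB _) hs ht

theorem norm_sub_sub_smul_le_of_lipschitzWith {Y : F → F} {L B : NNReal} (hL : LipschitzWith L Y)
    (hB : ∀ z, ‖Y z‖ ≤ B) {z : ℝ → F} (hz : ∀ t ∈ Icc (0 : ℝ) 1, HasDerivAt z (Y (z t)) t)
    {t h : ℝ} (ht : 0 ≤ t) (hh : 0 ≤ h) (hth : t + h ≤ 1) :
    ‖z (t + h) - z t - h • Y (z t)‖ ≤ L * B * h ^ 2 := by
  have hsub : ∀ s ∈ Icc t (t + h), s ∈ Icc (0 : ℝ) 1 := fun s hs =>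
    ⟨ht.trans hs.1, hs.2.trans hth⟩
  have hd : ∀ s ∈ Icc t (t + h), HasDerivWithinAt (fun s => z s - s • Y (z t))
      (Y (z s) - Y (z t)) (Icc t (t + h)) s := fun s hs => by
    have h1 := (hz s (hsub s hs)).fun_sub ((hasDerivAt_id s).smul_const (Y (z t)))
    rw [one_smul] at h1
    exact h1.hasDerivWithinAt
  have ht0 : t ∈ Icc t (t + h) := ⟨le_rfl, by linarith⟩
  have h1 := (convex_Icc t (t + h)).norm_image_sub_le_of_norm_hasDerivWithin_le hd
    (C := L * (B * h)) (fun s hs => by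
      refine (hL.norm_sub_le _ _).trans ?_
      gcongr
      refine (norm_sub_le_of_hasDerivAt_of_norm_le hB hz (hsub t ht0) (hsub s hs)).trans ?_
      rw [abs_of_nonneg (by linarith [hs.1])]
      gcongr
      linarith [hs.2]) ht0 (y := t + h) ⟨by linarith, le_rfl⟩
  rw [add_sub_cancel_left, Real.norm_of_nonneg hh] at h1
  calc ‖z (t + h) - z t - h • Y (z t)‖
      = ‖z (t + h) - (t + h) • Y (z t) - (z t - t • Y (z t))‖ := by
        congr 1; rw [add_smul]; abel
    _ ≤ L * (B * h) * h := h1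
    _ = L * B * h ^ 2 := by ring

/-- An approximate Euler scheme for a Lipschitz vector field stays close to the exact solution. -/
theorem norm_euler_sub_le {Y : F → F} {L B : NNReal} (hL : LipschitzWith L Y)
    (hB : ∀ z, ‖Y z‖ ≤ B) {z : ℝ → F} (hz : ∀ t ∈ Icc (0 : ℝ) 1, HasDerivAt z (Y (z t)) t)
    {N : ℕ} {C : ℝ} (hC : 0 ≤ C) {u : ℕ → F}
    (hu : ∀ i, i + 1 < N → ‖u (i + 1) - u i - (1 / N : ℝ) • Y (u i)‖ ≤ C / N ^ 2) :
    ∀ i < N, ‖u i - z (i / N)‖ ≤ (‖u 0 - z 0‖ + (C + L * B) / N) * Real.exp L := by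
  intro i hi
  have hN' : (0 : ℝ) < N := Nat.cast_pos.2 (by omega)
  let e : ℕ → ℝ := fun i => if i < N then ‖u i - z (i / N)‖ else 0
  have he0 : ∀ i, 0 ≤ e i := fun i => by simp only [e]; split_ifs <;> positivity
  have hstep : ∀ n ≥ 0, e (n + 1) ≤ (1 + L / N) * e n + (C + L * B) / N ^ 2 := by
    intro n _
    by_cases hn : n + 1 < N
    · simp only [e, if_pos hn, if_pos (Nat.lt_of_succ_lt hn)]
      have htn : ((n + 1 : ℕ) : ℝ) / N = n / N + 1 / N := by push_cast; ring
      have hle : (n : ℝ) / N + 1 / N ≤ 1 := by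
        rw [← htn, div_le_one hN']
        exact_mod_cast hn.le
      have h1 := norm_sub_sub_smul_le_of_lipschitzWith hL hB hz (t := n / N) (h := 1 / N)
        (by positivity) (by positivity) hle
      have h2 := hu n hn
      have h3 : ‖(1 / N : ℝ) • (Y (u n) - Y (z (n / N)))‖ ≤ L / N * ‖u n - z (n / N)‖ := by
        rw [norm_smul, Real.norm_of_nonneg (by positivity)]
        calc 1 / (N : ℝ) * ‖Y (u n) - Y (z (n / N))‖
            ≤ 1 / N * (L * ‖u n - z (n / N)‖) := by gcongr; exact hL.norm_sub_le _ _
          _ = L / N * ‖u n - z (n / N)‖ := by ring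
      have hdecomp : u (n + 1) - z ((n + 1 : ℕ) / N)
          = (u n - z (n / N)) + (u (n + 1) - u n - (1 / N : ℝ) • Y (u n))
            - (z (n / N + 1 / N) - z (n / N) - (1 / N : ℝ) • Y (z (n / N)))
            + (1 / N : ℝ) • (Y (u n) - Y (z (n / N))) := by
        rw [htn, smul_sub]
        abel
      rw [hdecomp]
      refine (norm_add_le _ _).trans ((add_le_add_left ((norm_sub_le _ _).trans
        (add_le_add_left (norm_add_le _ _) _)) _).trans ?_)
      have h4 : L * B * (1 / N : ℝ) ^ 2 = L * B / N ^ 2 := by field_simp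
      rw [h4] at h1
      rw [add_div]
      linarith
    · simp only [e, if_neg hn]
      have := he0 n
      positivity
  have h := discrete_gronwall_Ico (n₁ := N) (he0 0) hstep (fun _ _ => by positivity)
    (fun _ _ => by positivity) (Finset.mem_Ico.2 ⟨Nat.zero_le i, hi⟩)
  simp only [Finset.sum_const, Nat.card_Ico, Nat.sub_zero, nsmul_eq_mul] at h
  have e1 : (N : ℝ) * ((C + L * B) / N ^ 2) = (C + L * B) / N := by field_simp
  have e2 : (N : ℝ) * (L / N) = L := by field_simp
  rw [e1, e2] at h
  have e3 : e 0 = ‖u 0 - z 0‖ := by simp [e, (Nat.zero_le i).trans_lt hi]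
  rw [e3] at h
  simpa [e, hi] using h

end Euler

namespace RiemannianMetricOn

/-! ### Geodesic convexity -/

section Convexity

set_option maxSynthPendingDepth 4

variable {E : Type*} [NormedAddCommGroup E] [NormedSpace ℝ E] [FiniteDimensional ℝ E]
  {U : TopologicalSpace.Opens E} {g : RiemannianMetricOn U}

/-- The discrete energy minimisers satisfy the Euler scheme for the Hamiltonian vector field up to an
error of second order. -/
theorem norm_discretePhase_succ_le {Y : E × (E →L[ℝ] ℝ) → E × (E →L[ℝ] ℝ)} {L B : NNReal}
    (hL : LipschitzWith L Y) (hB : ∀ z, ‖Y z‖ ≤ B) {K' : Set E} (hK' : K' ⊆ U) {N : ℕ}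
    (hN : 0 < N) {x : ℕ → E} (hx : ∀ i, x i ∈ K')
    (hmin : ∀ y : ℕ → E, y 0 = x 0 → y N = x N → (∀ i, y i ∈ K') →
      g.discreteEnergy N x ≤ g.discreteEnergy N y)
    (hY : ∀ i < N, Y (g.discretePhase N x i) = g.hamiltonianField (g.discretePhase N x i))
    {i : ℕ} (hi : i + 1 < N) (hint : x (i + 1) ∈ interior K') :
    ‖g.discretePhase N x (i + 1) - g.discretePhase N x i
      - (1 / N : ℝ) • Y (g.discretePhase N x i)‖ ≤ L * B / N ^ 2 := by
  have hN' : (0 : ℝ) < N := Nat.cast_pos.2 hN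
  set u := g.discretePhase N x with hu
  have h1 : (u (i + 1)).1 - (u i).1 = (1 / N : ℝ) • (Y (u i)).1 := by
    rw [hY i (by omega)]
    exact discretePhase_fst_succ hN (hK' (hx i))
  have h2 : (u (i + 1)).2 - (u i).2 = (1 / N : ℝ) • (Y (u (i + 1))).2 := by
    rw [hY _ hi]
    exact discretePhase_snd_succ hK' hN hx hmin hi hint
  have hstep : ‖u (i + 1) - u i‖ ≤ B / N := by
    have h3 : ∀ z, (1 / N : ℝ) * ‖Y z‖ ≤ B / N := fun z => by
      rw [one_div_mul_eq_div]
      gcongr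
      exact hB z
    rw [Prod.norm_def, Prod.fst_sub, Prod.snd_sub, h1, h2, norm_smul, norm_smul,
      Real.norm_of_nonneg (by positivity)]
    refine max_le (le_trans ?_ (h3 (u i))) (le_trans ?_ (h3 (u (i + 1))))
    · gcongr
      exact norm_fst_le _
    · gcongr
      exact norm_snd_le _
  have h4 : u (i + 1) - u i - (1 / N : ℝ) • Y (u i)
      = (0, (1 / N : ℝ) • (Y (u (i + 1)) - Y (u i)).2) := by
    refine Prod.ext ?_ ?_
    · simp only [Prod.fst_sub, Prod.smul_fst, h1, sub_self]
    · simp only [Prod.snd_sub, Prod.smul_snd, h2, smul_sub]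
  rw [h4, Prod.norm_def, norm_zero, max_eq_right (norm_nonneg _), norm_smul,
    Real.norm_of_nonneg (by positivity)]
  calc 1 / (N : ℝ) * ‖(Y (u (i + 1)) - Y (u i)).2‖ ≤ 1 / N * (L * (B / N)) := by
        gcongr
        refine (norm_snd_le _).trans ((hL.norm_sub_le _ _).trans ?_)
        gcongr
    _ = L * B / N ^ 2 := by field_simp

/-- A limit of discrete energy minimisers is a Hamiltonian solution that connects the two points, and
whose speed is at most the geodesic distance. -/
theorem IsProper.exists_minimizing_hamiltonian (hg : g.IsProper) {p q : E} (hp : p ∈ U)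
    (hpq : g.pathDist p q ≠ ⊤) :
    ∃ z : ℝ → E × (E →L[ℝ] ℝ),
      (∀ t, z t ∈ cotangent U ∧ HasDerivAt z (g.hamiltonianField (z t)) t) ∧
      (z 0).1 = p ∧ (z 1).1 = q ∧ ∀ r, g.pathDist p q < ENNReal.ofReal r →
        g.tangentNorm (z 0).1 (g.sharp (z 0).1 (z 0).2) ≤ r := by
  obtain ⟨K, K', hK, hKK', hK'U, hpK, x, hx, hE⟩ := hg.exists_minimizers hp hpq
  have hKU : K ⊆ U := (hKK'.trans interior_subset).trans hK'U
  obtain ⟨M, hM⟩ := exists_bound_discretePhase_snd (g := g) hK hKU hKK' hK'U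
    ((g.pathDist p q).toReal + 1)
  have hE₀ := hE ((g.pathDist p q).toReal + 1) (by
    rw [ENNReal.lt_ofReal_iff_toReal_lt hpq]
    linarith)
  set u : ℕ → ℕ → E × (E →L[ℝ] ℝ) := fun N => g.discretePhase N (x N) with hu
  set Q₀ : Set (E × (E →L[ℝ] ℝ)) := K ×ˢ Metric.closedBall 0 M with hQ₀
  have hmemQ : ∀ᶠ N in atTop, ∀ i < N, u N i ∈ Q₀ := by
    filter_upwards [eventually_gt_atTop 0, hx, hE₀] with N hN ⟨h0, h1, h2, h3, h4⟩ hEN i hi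
    refine ⟨h2 i hi.le, mem_closedBall_zero_iff.2 ?_⟩
    exact hM N hN (x N) h2 h3 (fun y hy0 hy1 => h4 y (hy0.trans h0) (hy1.trans h1)) hEN i hi
  have hQ₀c : IsCompact Q₀ := hK.prod (isCompact_closedBall _ _)
  -- the initial momenta converge along a subsequence
  obtain ⟨z₀, hz₀Q, φ, hφ, hlim⟩ := hQ₀c.tendsto_subseq' (x := fun N => u N 0) (by
    refine Eventually.frequently ?_
    filter_upwards [eventually_gt_atTop 0, hmemQ] with N hN h using h 0 hN)
  obtain ⟨z, hz0, hz⟩ := hg.exists_hamiltonian_flow (z₀ := z₀) ⟨hKU hz₀Q.1, mem_univ _⟩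
  have hzc : Continuous z := continuous_iff_continuousAt.2 fun t => (hz t).2.continuousAt
  set Q := Q₀ ∪ z '' Icc 0 1 with hQ
  have hQc : IsCompact Q := hQ₀c.union (isCompact_Icc.image hzc)
  have hQU : Q ⊆ cotangent U := by
    rintro w (hw | ⟨t, -, rfl⟩)
    · exact ⟨hKU hw.1, mem_univ _⟩
    · exact (hz t).1
  obtain ⟨Y, L, B, hL, hB, hYX⟩ := exists_lipschitzWith_eventuallyEq_nhdsSet isOpen_cotangent
    g.contDiffOn_hamiltonianField hQc hQU
  have hYQ : ∀ w ∈ Q, Y w = g.hamiltonianField w := fun w hw => hYX.self_of_nhdsSet w hw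
  have hzY : ∀ t ∈ Icc (0 : ℝ) 1, HasDerivAt z (Y (z t)) t := fun t ht => by
    rw [hYQ _ (Or.inr (mem_image_of_mem z ht))]
    exact (hz t).2
  set err : ℕ → ℝ := fun N => (‖u N 0 - z 0‖ + (L * B + L * B) / N) * Real.exp L with herr
  have herrbound : ∀ᶠ N in atTop, ∀ i < N, ‖u N i - z (i / N)‖ ≤ err N := by
    filter_upwards [eventually_gt_atTop 0, hx, hmemQ] with N hN ⟨h0, h1, h2, h3, h4⟩ hmem
    exact norm_euler_sub_le hL hB hzY (by positivity) fun i hi =>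
      norm_discretePhase_succ_le hL hB hK'U hN h3
        (fun y hy0 hy1 => h4 y (hy0.trans h0) (hy1.trans h1))
        (fun j hj => hYQ _ (Or.inl (hmem j hj))) hi (hKK' (h2 _ hi.le))
  have hdiv : ∀ c : ℝ, Tendsto (fun k => c / φ k) atTop (𝓝 0) := fun c =>
    (tendsto_const_div_atTop_nhds_zero_nat c).comp hφ.tendsto_atTop
  have herrlim : Tendsto (fun k => err (φ k)) atTop (𝓝 0) := by
    have h1 : Tendsto (fun k => ‖u (φ k) 0 - z 0‖) atTop (𝓝 0) := by
      rw [← tendsto_iff_norm_sub_tendsto_zero, hz0]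
      exact hlim
    simpa using (h1.add (hdiv (L * B + L * B))).mul_const (Real.exp L)
  have hφev : ∀ {P : ℕ → Prop}, (∀ᶠ N in atTop, P N) → ∀ᶠ k in atTop, P (φ k) := fun h =>
    hφ.tendsto_atTop.eventually h
  refine ⟨z, hz, ?_, ?_, fun r hr => ?_⟩
  · have h1 : Tendsto (fun k => (u (φ k) 0).1) atTop (𝓝 z₀.1) :=
      (continuous_fst.tendsto z₀).comp hlim
    rw [hz0]
    refine tendsto_nhds_unique_of_eventuallyEq h1 tendsto_const_nhds ?_
    filter_upwards [hφev hx] with k hk using hk.1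
  · rw [← sub_eq_zero, ← norm_le_zero_iff]
    have hbound : Tendsto (fun k => B / φ k + err (φ k) + B / φ k) atTop (𝓝 (0 + 0 + 0)) :=
      ((hdiv B).add herrlim).add (hdiv B)
    rw [add_zero, add_zero] at hbound
    refine ge_of_tendsto hbound ?_
    filter_upwards [hφev (eventually_gt_atTop 0), hφev hx, hφev hmemQ, hφev herrbound] with
      k hN ⟨_, h1, _, h3, _⟩ hmem herr
    set N := φ k
    have hN' : (0 : ℝ) < N := Nat.cast_pos.2 hN
    have hlt : N - 1 < N := by omega
    have hcast : ((N - 1 : ℕ) : ℝ) = N - 1 := by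
      rw [Nat.cast_sub hN, Nat.cast_one]
    have hN1 : (1 : ℝ) ≤ N := by exact_mod_cast hN
    have e1 : ‖z 1 - z ((N - 1 : ℕ) / N)‖ ≤ B / N := by
      refine (norm_sub_le_of_hasDerivAt_of_norm_le hB hzY ⟨by positivity, ?_⟩
        ⟨zero_le_one, le_rfl⟩).trans_eq ?_
      · rw [div_le_one hN', hcast]
        linarith
      · have : (1 : ℝ) - (N - 1 : ℕ) / N = 1 / N := by rw [hcast]; field_simp; ring
        rw [this, abs_of_nonneg (by positivity), mul_one_div]
    have e2 := herr (N - 1) hlt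
    have e3 : ‖x N (N - 1) - q‖ ≤ B / N := by
      have h4 := discretePhase_fst_succ (g := g) hN (i := N - 1) (hK'U (h3 (N - 1)))
      rw [Nat.sub_add_cancel hN, h1] at h4
      rw [norm_sub_rev, h4, norm_smul, Real.norm_of_nonneg (by positivity), one_div_mul_eq_div]
      gcongr
      refine (norm_fst_le _).trans ?_
      rw [← hYQ _ (Or.inl (hmem _ hlt))]
      exact hB _
    have hdecomp : (z 1).1 - q = (z 1 - z ((N - 1 : ℕ) / N)).1
        - (u N (N - 1) - z ((N - 1 : ℕ) / N)).1 + (x N (N - 1) - q) := by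
      simp only [Prod.fst_sub, hu, discretePhase]
      abel
    rw [hdecomp]
    refine (norm_add_le _ _).trans (add_le_add ((norm_sub_le _ _).trans (add_le_add ?_ ?_)) e3)
    · exact (norm_fst_le _).trans e1
    · exact (norm_fst_le _).trans e2
  · have hr0 : 0 < r := ENNReal.ofReal_pos.1 (zero_le.trans_lt hr)
    set S : E × (E →L[ℝ] ℝ) → ℝ := fun w => g.tangentNorm w.1 (g.sharp w.1 w.2) with hS
    have hSc : ContinuousOn S (cotangent U) :=
      g.continuousOn_tangentNorm.comp (continuousOn_fst.prodMk g.contDiffOn_velocity.continuousOn)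
        fun w hw => ⟨hw.1, mem_univ _⟩
    have hSz : ∀ t, S (z t) = S (z 0) := fun t => by
      simp only [hS, tangentNorm]
      rw [form_velocity_eq isOpen_univ isPreconnected_univ (fun t _ => hz t) (mem_univ t)
        (mem_univ 0)]
    have huc := hQc.uniformContinuousOn_of_continuous (f := S) (hSc.mono hQU)
    refine le_of_forall_pos_le_add fun ε hε => ?_
    obtain ⟨δ, hδ, huc⟩ := Metric.uniformContinuousOn_iff_le.1 huc ε hε
    obtain ⟨k, hN, hxN, hmem, herr, hEN, hkδ⟩ := ((hφev (eventually_gt_atTop 0)).and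
      ((hφev hx).and ((hφev hmemQ).and ((hφev herrbound).and ((hφev (hE r hr)).and
        (herrlim.eventually_le_const hδ)))))).exists
    -- the smallest speed of the polygon is at most the root mean square of the speeds
    obtain ⟨i, hi, hform⟩ := exists_form_le_discreteEnergy (g := g) hN (x (φ k))
    have h1 : S (u (φ k) i) ≤ r := by
      simp only [hS, hu]
      rw [sharp_discretePhase (hK'U (hxN.2.2.2.1 i))]
      exact Real.sqrt_le_iff.2 ⟨hr0.le, hform.trans hEN⟩
    have ht : ((i : ℝ) / φ k) ∈ Icc (0 : ℝ) 1 := by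
      refine ⟨by positivity, div_le_one_of_le₀ ?_ (by positivity)⟩
      exact_mod_cast hi.le
    have h2 := huc _ (Or.inr (mem_image_of_mem z ht)) _ (Or.inl (hmem i hi)) (by
      rw [dist_comm, dist_eq_norm]
      exact (herr i hi).trans hkδ)
    rw [Real.dist_eq, hSz] at h2
    have h3 := (abs_le.1 h2).2
    change S (z 0) ≤ r + ε
    linarith

theorem IsProper.geodesicallyConvex (hg : g.IsProper)
    (hconn : ∀ p ∈ U, ∀ q ∈ U, g.pathDist p q ≠ ⊤) : g.GeodesicallyConvex := by
  intro p q
  have hpq := hconn p p.2 q q.2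
  obtain ⟨z, hz, h0, h1, hspeed⟩ := hg.exists_minimizing_hamiltonian p.2 hpq
  refine ⟨fun t => (z t).1, isGeodesicOn_of_hamiltonian hz (uniqueDiffOn_Icc_zero_one), h0, h1, ?_⟩
  have hps : PiecewiseSmoothOn U (fun t => (z t).1) 0 1 :=
    piecewiseSmoothOn_of_hamiltonian zero_le_one fun t _ => hz t
  refine le_antisymm ?_ (g.pathDist_le_length hps h0 h1)
  change _ ≤ g.pathDist p q
  rw [hps.length_eq g, curveLen_of_hamiltonian isOpen_univ isPreconnected_univ (fun t _ => hz t)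
    zero_le_one (subset_univ _) (mem_univ 0), sub_zero, one_mul]
  refine ENNReal.ofReal_le_of_le_toReal (le_of_forall_pos_le_add fun ε hε => hspeed _ ?_)
  rw [ENNReal.lt_ofReal_iff_toReal_lt hpq]
  linarith

end Convexity

end RiemannianMetricOn

namespace DiscreteCurve

/-! ### Connectedness of the space of discrete regular curves -/

section Connected

variable {d n : ℕ}

/-- The edge, as a linear function of the curve. -/
def edgeLinear (i : ZMod n) : Space d n →ₗ[ℝ] EuclideanSpace ℝ (Fin d) :=
  (LinearMap.proj (i + 1) : Space d n →ₗ[ℝ] EuclideanSpace ℝ (Fin d)) - LinearMap.proj i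

theorem edgeLinear_apply (i : ZMod n) (c : Space d n) : edgeLinear i c = edge c i := rfl

theorem edge_add_smul_sub (p w : Space d n) (t : ℝ) (i : ZMod n) :
    edge (p + t • (w - p)) i = (1 - t) • edge p i + t • edge w i := by
  simp only [← edgeLinear_apply, map_add, map_smul, map_sub]
  module

variable [NeZero n]

theorem edge_ne_zero_iff {c : Space d n} : c ∈ regularCurves d n ↔ ∀ i, edge c i ≠ 0 := by
  rw [mem_regularCurves]
  exact forall_congr' fun i => by rw [edge, sub_ne_zero, ne_comm]

theorem exists_edge_notMem_span (hn : 2 ≤ n) (hd : 2 ≤ d) (p q : Space d n) :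
    ∃ w : Space d n, ∀ i, edge w i ∉ Submodule.span ℝ {edge p i} ∧
      edge w i ∉ Submodule.span ℝ {edge q i} := by
  -- otherwise the whole space would be a finite union of proper subspaces
  by_contra! hcon
  let V : ZMod n ⊕ ZMod n → Submodule ℝ (Space d n) := Sum.elim
    (fun i => (Submodule.span ℝ {edge p i}).comap (edgeLinear i))
    (fun i => (Submodule.span ℝ {edge q i}).comap (edgeLinear i))
  have hcover : ⋃ k, (V k : Set (Space d n)) = univ := by
    refine eq_univ_of_forall fun w => mem_iUnion.2 ?_
    obtain ⟨i, hi⟩ := hcon w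
    by_cases h : edge w i ∈ Submodule.span ℝ {edge p i}
    · exact ⟨Sum.inl i, h⟩
    · exact ⟨Sum.inr i, hi h⟩
  have hne : ∀ (i : ZMod n) (a : EuclideanSpace ℝ (Fin d)),
      (Submodule.span ℝ {a}).comap (edgeLinear (d := d) i) ≠ ⊤ := by
    intro i a htop
    have : Fact (1 < n) := ⟨hn⟩
    have hi : i + 1 ≠ i := by simp
    have hspan : Submodule.span ℝ {a} = ⊤ := by
      refine eq_top_iff.2 fun v _ => ?_
      have h1 : Pi.single (i + 1) v ∈ (Submodule.span ℝ {a}).comap (edgeLinear (d := d) i) := by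
        rw [htop]; trivial
      have h2 : edgeLinear (d := d) i (Pi.single (i + 1) v) = v := by
        rw [edgeLinear_apply, edge, Pi.single_eq_same, Pi.single_eq_of_ne hi.symm, sub_zero]
      rwa [Submodule.mem_comap, h2] at h1
    have h1 := finrank_span_le_card (R := ℝ) ({a} : Set (EuclideanSpace ℝ (Fin d)))
    rw [hspan, finrank_top, finrank_euclideanSpace_fin] at h1
    simp at h1
    omega
  obtain ⟨k, hk⟩ := Subspace.exists_eq_top_of_iUnion_eq_univ hcover
  rcases k with i | i
  exacts [hne i _ hk, hne i _ hk]

theorem segment_mem_regularCurves {p w : Space d n} (hp : p ∈ regularCurves d n)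
    (hw : ∀ i, edge w i ∉ Submodule.span ℝ {edge p i}) (t : ℝ) :
    p + t • (w - p) ∈ regularCurves d n := by
  rw [edge_ne_zero_iff] at hp ⊢
  intro i h
  rw [edge_add_smul_sub] at h
  rcases eq_or_ne t 0 with rfl | ht
  · simp [hp i] at h
  · refine hw i (Submodule.mem_span_singleton.2 ⟨-(t⁻¹ * (1 - t)), ?_⟩)
    rw [neg_smul, mul_smul, eq_neg_of_add_eq_zero_left h, smul_neg, neg_neg, inv_smul_smul₀ ht]

/-- Any two curves are joined by two segments, through a third curve whose edges are not parallel to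
the corresponding edges of either of them. -/
theorem pathDist_ne_top (m : ℕ) (hn : 2 ≤ n) (hd : 2 ≤ d) (p : Space d n)
    (hp : p ∈ regularCurves d n) (q : Space d n) (hq : q ∈ regularCurves d n) :
    (sobolevMetric d n m).pathDist p q ≠ ⊤ := by
  obtain ⟨w, hw⟩ := exists_edge_notMem_span hn hd p q
  have hseg : ∀ p ∈ regularCurves d n, (∀ i, edge w i ∉ Submodule.span ℝ {edge p i}) →
      (sobolevMetric d n m).pathDist p w ≠ ⊤ := by
    intro p hp hpw
    have h : RiemannianMetricOn.PiecewiseSmoothOn (regularCurves d n)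
        (fun t : ℝ => p + t • (w - p)) 0 1 :=
      .smooth zero_le_one (fun t _ => segment_mem_regularCurves hp hpw t) (by fun_prop)
    have h1 := h.pathDist_le (sobolevMetric d n m)
    simp only [zero_smul, add_zero, one_smul, add_sub_cancel] at h1
    exact ne_top_of_le_ne_top ENNReal.ofReal_ne_top h1
  refine ne_top_of_le_ne_top (ENNReal.add_ne_top.2 ⟨hseg p hp fun i => (hw i).1, ?_⟩)
    ((sobolevMetric d n m).pathDist_triangle p w q)
  rw [RiemannianMetricOn.pathDist_comm]
  exact hseg q hq fun i => (hw i).2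

end Connected

/-! ### Estimates for the discrete arc length derivatives -/

section Estimates

variable {d n : ℕ} [NeZero n]

theorem norm_sub_le_of_norm_succ_sub_le {V : Type*} [SeminormedAddCommGroup V]
    {f : ZMod n → V} {A : ℝ} (h : ∀ i, ‖f (i + 1) - f i‖ ≤ A) (i j : ZMod n) :
    ‖f i - f j‖ ≤ n * A := by
  have hA : 0 ≤ A := (norm_nonneg _).trans (h 0)
  have key : ∀ k : ℕ, ‖f (j + k) - f j‖ ≤ k * A := by
    intro k
    induction k with
    | zero => simp
    | succ k ih =>
      have h1 := h (j + k)
      rw [add_assoc] at h1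
      push_cast
      have h2 := norm_sub_le_norm_sub_add_norm_sub (f (j + (k + 1))) (f (j + k)) (f j)
      linarith
  have h1 := key (i - j).val
  rw [ZMod.natCast_zmod_val, add_sub_cancel] at h1
  refine h1.trans ?_
  gcongr
  exact (ZMod.val_lt _).le

theorem norm_le_of_sum_smul_eq_zero {V : Type*} [NormedAddCommGroup V] [NormedSpace ℝ V]
    {f : ZMod n → V} {A : ℝ} (h : ∀ i, ‖f (i + 1) - f i‖ ≤ A) {w : ZMod n → ℝ}
    (hw : ∀ i, 0 < w i) (hsum : ∑ i, w i • f i = 0) (i : ZMod n) : ‖f i‖ ≤ n * A := by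
  have hpos : 0 < ∑ j, w j := Finset.sum_pos (fun j _ => hw j) Finset.univ_nonempty
  have h1 : (∑ j, w j) • f i = ∑ j, w j • (f i - f j) := by
    simp only [smul_sub, Finset.sum_sub_distrib, hsum, sub_zero, Finset.sum_smul]
  have h2 : (∑ j, w j) * ‖f i‖ ≤ (∑ j, w j) * (n * A) := by
    rw [← Real.norm_of_nonneg hpos.le, ← norm_smul, h1, Real.norm_of_nonneg hpos.le,
      Finset.sum_mul]
    refine norm_sum_le_of_le _ fun j _ => ?_
    rw [norm_smul, Real.norm_of_nonneg (hw j).le]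
    exact mul_le_mul_of_nonneg_left (norm_sub_le_of_norm_succ_sub_le h i j) (hw j).le
  exact le_of_mul_le_mul_left h2 hpos

theorem norm_edge_le_curveLength (c : Space d n) (i : ZMod n) : ‖edge c i‖ ≤ curveLength c :=
  Finset.single_le_sum (f := fun i => ‖edge c i‖) (fun _ _ => norm_nonneg _) (Finset.mem_univ i)

theorem weight_le_curveLength (m : ℕ) (c : Space d n) (i : ZMod n) :
    weight m c i ≤ curveLength c := by
  have h1 := norm_edge_le_curveLength c i
  have h2 := norm_edge_le_curveLength c (i - 1)
  unfold weight vertexWeight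
  split_ifs <;> linarith

/-- The arc length derivatives have vanishing weighted mean, since the curve is closed. -/
theorem sum_weight_smul_discreteDeriv {c : Space d n} (hc : c ∈ regularCurves d n)
    (h : Space d n) (j : ℕ) :
    ∑ i, weight (j + 1) c i • discreteDeriv c h (j + 1) i = 0 := by
  have hshift : ∑ i, discreteDeriv c h j (i + 1) = ∑ i, discreteDeriv c h j i :=
    Equiv.sum_comp (Equiv.addRight (1 : ZMod n)) (discreteDeriv c h j)
  have hshift' : ∑ i, discreteDeriv c h j (i - 1) = ∑ i, discreteDeriv c h j i :=
    Equiv.sum_comp (Equiv.subRight (1 : ZMod n)) (discreteDeriv c h j)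
  by_cases hj : Even j
  · have hj' : ¬ Even (j + 1) := by simpa [Nat.even_add_one] using hj
    simp only [discreteDeriv, weight, if_pos hj, if_neg hj', smul_smul,
      mul_inv_cancel₀ (norm_edge_pos hc _).ne', one_smul, Finset.sum_sub_distrib, hshift, sub_self]
  · have hj' : Even (j + 1) := by simpa [Nat.even_add_one] using hj
    simp only [discreteDeriv, weight, if_neg hj, if_pos hj', smul_smul,
      mul_inv_cancel₀ (vertexWeight_pos hc _).ne', one_smul, Finset.sum_sub_distrib, hshift',
      sub_self]

theorem norm_discreteDeriv_succ_sub_le {c : Space d n} (hc : c ∈ regularCurves d n)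
    {h : Space d n} {j : ℕ} {A : ℝ}
    (hA : ∀ i, weight (j + 1) c i * ‖discreteDeriv c h (j + 1) i‖ ≤ A) (i : ZMod n) :
    ‖discreteDeriv c h j (i + 1) - discreteDeriv c h j i‖ ≤ A := by
  by_cases hj : Even j
  · have hj' : ¬ Even (j + 1) := by simpa [Nat.even_add_one] using hj
    have h1 := hA i
    rwa [← Real.norm_of_nonneg (weight_pos (j + 1) hc i).le, ← norm_smul, weight, if_neg hj',
      discreteDeriv, if_pos hj, smul_smul, mul_inv_cancel₀ (norm_edge_pos hc i).ne',
      one_smul] at h1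
  · have hj' : Even (j + 1) := by simpa [Nat.even_add_one] using hj
    have h1 := hA (i + 1)
    rwa [← Real.norm_of_nonneg (weight_pos (j + 1) hc (i + 1)).le, ← norm_smul, weight,
      if_pos hj', discreteDeriv, if_neg hj, smul_smul,
      mul_inv_cancel₀ (vertexWeight_pos hc (i + 1)).ne', one_smul, add_sub_cancel_right] at h1

/-- A discrete Poincaré inequality: as the derivatives of order at least one have vanishing weighted
mean, their supremum is bounded by their increments. -/
theorem norm_discreteDeriv_succ_le {c : Space d n} (hc : c ∈ regularCurves d n)
    {h : Space d n} {j : ℕ} {A : ℝ}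
    (hA : ∀ i, weight (j + 2) c i * ‖discreteDeriv c h (j + 2) i‖ ≤ A) (i : ZMod n) :
    ‖discreteDeriv c h (j + 1) i‖ ≤ n * A :=
  norm_le_of_sum_smul_eq_zero (norm_discreteDeriv_succ_sub_le hc hA)
    (fun i => weight_pos (j + 1) hc i) (sum_weight_smul_discreteDeriv hc h j) i

theorem sobolevMetric_form (m : ℕ) (c h k : Space d n) :
    (sobolevMetric d n m).form c h k = sobolevForm m c h k := rfl

theorem homogeneousForm_term_le {m : ℕ} {c : Space d n} (hc : c ∈ regularCurves d n)
    (h : Space d n) (i : ZMod n) :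
    curveLength c ^ (2 * (m : ℤ) - 3) * ‖discreteDeriv c h m i‖ ^ 2 * weight m c i
      ≤ homogeneousForm m c h h := by
  unfold homogeneousForm
  rw [← real_inner_self_eq_norm_sq]
  exact Finset.single_le_sum (f := fun i => curveLength c ^ (2 * (m : ℤ) - 3) *
      inner ℝ (discreteDeriv c h m i) (discreteDeriv c h m i) * weight m c i)
    (fun i _ => mul_nonneg (mul_nonneg (zpow_nonneg (curveLength_pos hc).le _)
      real_inner_self_nonneg) (weight_pos m hc i).le) (Finset.mem_univ i)

theorem curveLength_pow_mul_weight_mul_norm_le (k : ℕ) {c : Space d n}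
    (hc : c ∈ regularCurves d n) (h : Space d n) (i : ZMod n) :
    curveLength c ^ k * (weight (k + 2) c i * ‖discreteDeriv c h (k + 2) i‖)
      ≤ (sobolevMetric d n (k + 2)).tangentNorm c h := by
  have hℓ := curveLength_pos hc
  have hw := weight_pos (k + 2) hc i
  refine Real.le_sqrt_of_sq_le ?_
  have h1 := homogeneousForm_term_le (m := k + 2) hc h i
  have h0 := homogeneousForm_self_nonneg 0 hc h
  have he : 2 * ((k + 2 : ℕ) : ℤ) - 3 = ((2 * k + 1 : ℕ) : ℤ) := by push_cast; ring
  rw [he, zpow_natCast] at h1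
  rw [sobolevMetric_form, sobolevForm]
  calc (curveLength c ^ k * (weight (k + 2) c i * ‖discreteDeriv c h (k + 2) i‖)) ^ 2
      = curveLength c ^ (2 * k) * ‖discreteDeriv c h (k + 2) i‖ ^ 2 * weight (k + 2) c i
        * weight (k + 2) c i := by ring
    _ ≤ curveLength c ^ (2 * k) * ‖discreteDeriv c h (k + 2) i‖ ^ 2 * weight (k + 2) c i
        * curveLength c := by gcongr; exact weight_le_curveLength _ _ _
    _ = curveLength c ^ (2 * k + 1) * ‖discreteDeriv c h (k + 2) i‖ ^ 2 * weight (k + 2) c i := by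
        ring
    _ ≤ _ := by linarith

/-- The first arc length derivative is controlled by the metric, uniformly in the curve: this is
where scale invariance and `m ≥ 2` enter. -/
theorem norm_discreteDeriv_one_le (k : ℕ) {c : Space d n} (hc : c ∈ regularCurves d n)
    (h : Space d n) (i : ZMod n) :
    ‖discreteDeriv c h 1 i‖ ≤ n ^ (k + 1) * (sobolevMetric d n (k + 2)).tangentNorm c h := by
  have hℓ := curveLength_pos hc
  set G := (sobolevMetric d n (k + 2)).tangentNorm c h with hG
  -- downward induction on the order `r + 1` of the derivative, starting from `m - 1 = k + 1`
  have key : ∀ s r : ℕ, r + s = k → ∀ i,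
      curveLength c ^ r * ‖discreteDeriv c h (r + 1) i‖ ≤ n ^ (s + 1) * G := by
    intro s
    induction s with
    | zero =>
      intro r hr i
      obtain rfl : r = k := by omega
      have h1 := norm_discreteDeriv_succ_le hc (A := G / curveLength c ^ r) (fun j => by
        rw [le_div_iff₀' (by positivity)]
        exact curveLength_pow_mul_weight_mul_norm_le r hc h j) i
      rw [← mul_div_assoc, le_div_iff₀' (by positivity)] at h1
      simpa using h1
    | succ s ih =>
      intro r hr i
      have h1 := norm_discreteDeriv_succ_le hc (A := n ^ (s + 1) * G / curveLength c ^ r)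
        (fun j => by
          rw [le_div_iff₀' (by positivity)]
          refine le_trans ?_ (ih (r + 1) (by omega) j)
          rw [pow_succ, mul_assoc]
          gcongr
          exact weight_le_curveLength _ _ _) i
      rw [← mul_div_assoc, le_div_iff₀' (by positivity)] at h1
      rw [pow_succ _ (s + 1)]
      linarith
  simpa using key k 0 (zero_add k) i

/-- In other words, the logarithms of the edge lengths are Lipschitz functions on the space of
curves, since an edge changes at the rate `edge h i` in the direction `h`. -/
theorem norm_edge_tangent_le (k : ℕ) {c : Space d n} (hc : c ∈ regularCurves d n)
    (h : Space d n) (i : ZMod n) :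
    ‖edge h i‖ ≤ ‖edge c i‖ * (n ^ (k + 1) * (sobolevMetric d n (k + 2)).tangentNorm c h) := by
  have h1 := norm_discreteDeriv_one_le k hc h i
  have he := norm_edge_pos hc i
  have h2 : discreteDeriv c h 1 i = ‖edge c i‖⁻¹ • edge h i := by
    simp [discreteDeriv, edge]
  rwa [h2, norm_smul, norm_inv, norm_norm, inv_mul_le_iff₀ he] at h1

/-- The zeroth order part of the metric controls the displacement of the vertices as soon as the edge
lengths are bounded from above and below. -/
theorem norm_le_tangentNorm_of_bounds (m : ℕ) {c : Space d n} (hc : c ∈ regularCurves d n)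
    {a b : ℝ} (ha : 0 < a) (hab : ∀ i, a ≤ ‖edge c i‖ ∧ ‖edge c i‖ ≤ b) (h : Space d n) :
    ‖h‖ ≤ √((n * b) ^ 3 / a) * (sobolevMetric d n m).tangentNorm c h := by
  have hb : 0 < b := ha.trans_le ((hab 0).1.trans (hab 0).2)
  have hn : (0 : ℝ) < n := Nat.cast_pos.2 (NeZero.pos n)
  have hℓ := curveLength_pos hc
  have hG := (sobolevMetric d n m).tangentNorm_nonneg c h
  refine (pi_norm_le_iff_of_nonneg (by positivity)).2 fun i => ?_
  have h1 := homogeneousForm_term_le (m := 0) hc h i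
  have h0 := homogeneousForm_self_nonneg m hc h
  have hℓb : curveLength c ≤ n * b := by
    have h2 : curveLength c ≤ ∑ _ : ZMod n, b := Finset.sum_le_sum fun i _ => (hab i).2
    simpa [ZMod.card] using h2
  have hμ : a ≤ weight 0 c i := by
    simp only [weight, vertexWeight, Even.zero, if_true]
    linarith [(hab i).1, (hab (i - 1)).1]
  refine le_of_sq_le_sq ?_ (by positivity)
  rw [mul_pow, Real.sq_sqrt (by positivity), RiemannianMetricOn.sq_tangentNorm _ hc,
    sobolevMetric_form, sobolevForm, div_mul_eq_mul_div, le_div_iff₀ ha]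
  have he : 2 * ((0 : ℕ) : ℤ) - 3 = -((3 : ℕ) : ℤ) := by norm_num
  rw [he, zpow_neg, zpow_natCast, mul_assoc, inv_mul_le_iff₀ (by positivity)] at h1
  change ‖h i‖ ^ 2 * weight 0 c i ≤ _ at h1
  calc ‖h i‖ ^ 2 * a ≤ ‖h i‖ ^ 2 * weight 0 c i := by gcongr
    _ ≤ curveLength c ^ 3 * homogeneousForm 0 c h h := h1
    _ ≤ (n * b) ^ 3 * homogeneousForm 0 c h h := by
      have := homogeneousForm_self_nonneg 0 hc h
      gcongr
    _ ≤ (n * b) ^ 3 * (homogeneousForm 0 c h h + homogeneousForm m c h h) := by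
      gcongr
      linarith

end Estimates

/-! ### Properness -/

section Proper

variable {d n : ℕ} [NeZero n]

theorem hasFDerivAt_log_norm_edge {c : Space d n} (hc : c ∈ regularCurves d n) (i : ZMod n) :
    ∃ f' : Space d n →L[ℝ] ℝ, HasFDerivAt (fun c : Space d n => Real.log ‖edge c i‖) f' c ∧
      ∀ h, ‖f' h‖ ≤ ‖edge h i‖ / ‖edge c i‖ := by
  have he := norm_edge_pos hc i
  have h1 : HasFDerivAt (fun c : Space d n => edge c i)
      (LinearMap.toContinuousLinearMap (edgeLinear i)) c :=
    (LinearMap.toContinuousLinearMap (edgeLinear (d := d) i)).hasFDerivAt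
  -- the square of the norm is smooth, so `log ‖·‖` is treated as `log ‖·‖ ^ 2 / 2`
  have h2 := (h1.norm_sq.log (by positivity)).const_mul (1 / 2)
  refine ⟨_, h2.congr_of_eventuallyEq (Eventually.of_forall fun c => ?_), fun h => ?_⟩
  · simp only [Real.log_pow]
    push_cast
    ring
  · have h3 := abs_real_inner_le_norm (edge c i) (edge h i)
    simp only [smul_apply, ContinuousLinearMap.comp_apply,
      LinearMap.coe_toContinuousLinearMap', edgeLinear_apply, innerSL_apply_apply, smul_eq_mul,
      nsmul_eq_mul, Nat.cast_ofNat, Real.norm_eq_abs]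
    have h4 : 1 / 2 * ((‖edge c i‖ ^ 2)⁻¹ * (2 * inner ℝ (edge c i) (edge h i)))
        = inner ℝ (edge c i) (edge h i) / ‖edge c i‖ ^ 2 := by field_simp
    rw [h4, abs_div, abs_of_pos (by positivity : (0 : ℝ) < ‖edge c i‖ ^ 2),
      div_le_div_iff₀ (by positivity) he]
    calc |inner ℝ (edge c i) (edge h i)| * ‖edge c i‖
        ≤ ‖edge c i‖ * ‖edge h i‖ * ‖edge c i‖ := by gcongr
      _ = ‖edge h i‖ * ‖edge c i‖ ^ 2 := by ring

theorem abs_log_norm_edge_sub_le (k : ℕ) {γ : ℝ → Space d n} {a b : ℝ}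
    (hγ : RiemannianMetricOn.PiecewiseSmoothOn (regularCurves d n) γ a b) (i : ZMod n) :
    |Real.log ‖edge (γ b) i‖ - Real.log ‖edge (γ a) i‖|
      ≤ n ^ (k + 1) * (sobolevMetric d n (k + 2)).curveLen γ a b := by
  choose! f' hf' hbound using fun (c : Space d n) (hc : c ∈ regularCurves d n) =>
    hasFDerivAt_log_norm_edge hc i
  refine hγ.norm_sub_le (sobolevMetric d n (k + 2)) (f := fun c => Real.log ‖edge c i‖)
    (f' := f') (fun t ht => hf' _ (hγ.mem t ht)) fun t ht v => ?_
  refine (hbound _ (hγ.mem t ht) v).trans ?_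
  rw [div_le_iff₀' (norm_edge_pos (hγ.mem t ht) i)]
  exact norm_edge_tangent_le k (hγ.mem t ht) v i

/-- Along a curve of bounded length starting at `p`, the edge lengths stay between two positive
bounds, hence the vertices stay in a bounded region. -/
theorem isProper_sobolevMetric (k : ℕ) : (sobolevMetric d n (k + 2)).IsProper := by
  intro p hp R
  set R' := max R 0 + 1 with hR'
  have hR0 : 0 < R' := by positivity
  set C : ℝ := n ^ (k + 1) * R' with hC
  obtain ⟨i₀, hi₀⟩ := Finite.exists_min fun i => ‖edge p i‖
  obtain ⟨i₁, hi₁⟩ := Finite.exists_max fun i => ‖edge p i‖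
  set a := ‖edge p i₀‖ * Real.exp (-C) with ha
  set b := ‖edge p i₁‖ * Real.exp C with hb
  have ha0 : 0 < a := mul_pos (norm_edge_pos hp i₀) (Real.exp_pos _)
  set M := √((n * b) ^ 3 / a) * R' with hM
  have hedge : ∀ i, Continuous fun c : Space d n => edge c i := fun i => by
    unfold edge
    fun_prop
  refine ⟨Metric.closedBall p M ∩ {c | ∀ i, a ≤ ‖edge c i‖}, fun c hc => ?_, ?_, fun q hq => ?_⟩
  · exact edge_ne_zero_iff.2 fun i => norm_pos_iff.1 (ha0.trans_le (hc.2 i))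
  · refine (isCompact_closedBall p M).inter_right ?_
    rw [ofPred_forall]
    exact isClosed_iInter fun i => isClosed_le continuous_const (hedge i).norm
  have hq' : (sobolevMetric d n (k + 2)).pathDist p q < ENNReal.ofReal R' := by
    refine hq.trans_lt ?_
    rw [ENNReal.ofReal_lt_ofReal_iff hR0]
    linarith [le_max_left R 0]
  obtain ⟨γ, hγ, rfl, rfl, hlen⟩ := RiemannianMetricOn.exists_curveLen_lt _ hq'
  have hbounds : ∀ t ∈ Icc (0 : ℝ) 1, ∀ i, a ≤ ‖edge (γ t) i‖ ∧ ‖edge (γ t) i‖ ≤ b := by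
    intro t ht i
    have h1 := abs_log_norm_edge_sub_le k (hγ.restrict le_rfl ht.1 ht.2) i
    have h2 := (hγ.restrict le_rfl ht.1 ht.2).curveLen_add (sobolevMetric d n (k + 2))
      (hγ.restrict ht.1 ht.2 le_rfl)
    have h3 := (sobolevMetric d n (k + 2)).curveLen_nonneg γ ht.2
    have h4 : (n : ℝ) ^ (k + 1) * (sobolevMetric d n (k + 2)).curveLen γ 0 t ≤ C := by
      rw [hC]
      gcongr
      linarith
    obtain ⟨h5, h6⟩ := abs_le.1 (h1.trans h4)
    have ep := norm_edge_pos hp i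
    have et := norm_edge_pos (hγ.mem t ht) i
    constructor
    · calc a ≤ ‖edge (γ 0) i‖ * Real.exp (-C) := by rw [ha]; gcongr; exact hi₀ i
        _ = Real.exp (Real.log ‖edge (γ 0) i‖ - C) := by
          rw [sub_eq_add_neg, Real.exp_add, Real.exp_log ep]
        _ ≤ Real.exp (Real.log ‖edge (γ t) i‖) := Real.exp_le_exp.2 (by linarith)
        _ = ‖edge (γ t) i‖ := Real.exp_log et
    · calc ‖edge (γ t) i‖ = Real.exp (Real.log ‖edge (γ t) i‖) := (Real.exp_log et).symm
        _ ≤ Real.exp (Real.log ‖edge (γ 0) i‖ + C) := Real.exp_le_exp.2 (by linarith)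
        _ = ‖edge (γ 0) i‖ * Real.exp C := by rw [Real.exp_add, Real.exp_log ep]
        _ ≤ b := by rw [hb]; gcongr; exact hi₁ i
  refine ⟨?_, fun i => (hbounds 1 ⟨zero_le_one, le_rfl⟩ i).1⟩
  rw [mem_closedBall_iff_norm]
  have h1 := hγ.norm_sub_le (sobolevMetric d n (k + 2)) (f := fun c => c)
    (f' := fun _ => ContinuousLinearMap.id ℝ (Space d n)) (C := √((n * b) ^ 3 / a))
    (fun t _ => hasFDerivAt_id _) fun t ht v =>
      norm_le_tangentNorm_of_bounds (k + 2) (hγ.mem t ht) ha0 (hbounds t ht) v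
  refine h1.trans ?_
  rw [hM]
  gcongr

end Proper

end DiscreteCurve

theorem mainTheorem1 (m n d : ℕ) [NeZero n] (hm : 2 ≤ m) (hn : 3 ≤ n) (hd : 2 ≤ d) :
    (DiscreteCurve.sobolevMetric d n m).MetricallyComplete ∧
      (DiscreteCurve.sobolevMetric d n m).GeodesicallyComplete ∧
      (DiscreteCurve.sobolevMetric d n m).GeodesicallyConvex := by
  have hconn := DiscreteCurve.pathDist_ne_top (n := n) (d := d) m (by omega) hd
  obtain ⟨k, rfl⟩ := Nat.exists_eq_add_of_le' hm
  have hproper := DiscreteCurve.isProper_sobolevMetric (d := d) (n := n) k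
  exact ⟨hproper.metricallyComplete hconn, hproper.geodesicallyComplete,
    hproper.geodesicallyConvex hconn⟩

end
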